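/- For a graph $F$ and an integer $t \ge 2$, let $r(F,t)$ be the minimum $N$ such that every $F$-free graph on $N$ vertices contains an independent set of order $t$. For integers $n \ge m$ and $b \ge a$, an $(m,n,a,b)$-graph is a bipartite graph with parts of sizes $m$ and $n$ in which every vertex in the part of size $n$ has degree $a$ and every vertex in the part of size $m$ has degree $b$. Write $\log$ for the logarithm to base $2$. Theorem. Let $\ell \ge 1$ be an integer, let $\alpha_0 \ge 1$ and $0 < \beta \le (\ell+1)/(2\ell+1)$ be real numbers, and let $c > 0$. There is a constant $C > 0$, depending only on $\ell$, $\alpha_0$, $\beta$ and $c$, such that the following holds. Suppose that $(G_i)_{i \ge 0}$ is an infinite sequence of $(m_i,n_i,a_i,b_i)$-graphs with $n_i \to \infty$, each of girth larger than $4\ell+2$ and with $1 \le \alpha_i := \log_{a_i} b_i \le \alpha_0$ (in particular $a_i \ge 2$), such that $G_i$ has at least $c\,(m_i n_i)^{\beta}$ edges for all sufficiently large $i$. Then there is a sequence of integers $t_i \ge 2$ with $t_i \to \infty$ such that, for every $i$, \[ r(C_{2\ell+1}, t_i) \;\ge\; C\, \frac{t_i^{\frac{\alpha_i\beta - 3\beta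 + 2}{\alpha_i - 3\beta - \alpha_i\beta + 2}}}{(\log t_i)^{\frac{3\alpha_i\beta - \alpha_i - 3\beta + 2}{\alpha_i - 3\beta - \alpha_i\beta + 2}}}. \] -/

import Mathlib

/-- The `F`-complete Ramsey number `r(F, t)`: the minimum `N` such that every `F`-free graph on
`N` vertices contains an independent set of order `t`. (Such `N` exist by Ramsey's theorem.) -/
noncomputable def ramseyNumber {W : Type*} (F : SimpleGraph W) (t : ℕ) : ℕ :=
  sInf {N : ℕ | ∀ H : SimpleGraph (Fin N), F.Free H → ∃ s : Finset (Fin N), H.IsNIndepSet t s}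

/-- `G` is an `(m, n, a, b)`-graph: an `m` by `n` bipartite graph, with parts `Fin m` and `Fin n`,
where `m ≤ n`, all vertices in the part of size `n` have degree `a`, all vertices in the part of
size `m` have degree `b`, and `a ≤ b`. -/
structure IsMNABGraph (m n a b : ℕ) (G : SimpleGraph (Fin m ⊕ Fin n)) : Prop where
  not_adj_left : ∀ u u' : Fin m, ¬ G.Adj (Sum.inl u) (Sum.inl u')
  not_adj_right : ∀ v v' : Fin n, ¬ G.Adj (Sum.inr v) (Sum.inr v')
  m_le_n : m ≤ n
  a_le_b : a ≤ b
  degree_right : ∀ v : Fin n, (G.neighborSet (Sum.inr v)).ncard = a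
  degree_left : ∀ u : Fin m, (G.neighborSet (Sum.inl u)).ncard = b

/-! ### Weighted generating function of independent sets -/

section PartitionFunction

open Finset

variable {V U : Type*} [DecidableEq U]

/-! Let `U` and `V` be the parts of sizes `m` and `n`. The neighbourhoods in `V` of the points of
`U` are blocks, any two sharing at most one vertex. Two-colour every block at random and join its
two colour classes completely. A cycle of length `2ℓ+1` in the union would lift to a closed sequence
of `4ℓ+2` incidences; the girth forces it into a single block, where the graph is bipartite, which
is impossible for an odd cycle (`splitGraph_free`).

To count independent `t`-sets, bound `Z = ∑ y^|S| P(S independent)`. Building `S` vertex by vertex,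
each chosen vertex fixes the colour of its blocks, and a vertex in `k` fixed blocks is compatible
with probability `2^(-k)`, its weight. While the total weight exceeds order `m/a`, some vertex, if
chosen, lowers it by a factor `1 - Θ(a²/m)` (`exists_totalWeight_decrement`). So about `(m/a²) log
n` such choices suffice (`partitionFn_le`), and `Z ≤ exp(O((m/a²) log² n))` at `y = log² n / a`. For
`t` of the order of that exponent, some colouring has at most `(e/y)^t` independent `t`-sets, and
some set of about `yn/8` vertices contains none of them.

Finally `na = mb` and the edge density convert this bound into a power of `t` (`exponent_mul_le`).
For `β ≤ 1/2` the claim is at most linear in `t` and follows from `r(F,t) ≥ t`. -/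

/-- The weight `2 ^ (-|N v ∩ I|)` of a vertex `v`, given the set `I` of points already hit. -/
noncomputable def hitWeight (N : V → Finset U) (I : Finset U) (v : V) : ℝ :=
  (1 / 2) ^ #(N v ∩ I)

/-- The total weight of the vertices of `X`. -/
noncomputable def totalWeight (N : V → Finset U) (X : Finset V) (I : Finset U) : ℝ :=
  ∑ x ∈ X, hitWeight N I x

/-- The probability that a uniformly random two-colouring of every block is constant on the trace
of `S` on that block, the colour being prescribed for the blocks in `I`. -/
noncomputable def setProb [Fintype U] (N : V → Finset U) (I : Finset U) (S : Finset V) : ℝ :=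
  ∏ u, (1 / 2) ^ (if u ∈ I then #{x ∈ S | u ∈ N x} else #{x ∈ S | u ∈ N x} - 1)

/-- The generating function of `setProb` over the subsets of `X`. -/
noncomputable def partitionFn [Fintype U] (N : V → Finset U) (y : ℝ) (X : Finset V)
    (I : Finset U) : ℝ :=
  ∑ S ∈ X.powerset, y ^ #S * setProb N I S

lemma hitWeight_pos (N : V → Finset U) (I : Finset U) (v : V) : 0 < hitWeight N I v := by
  unfold hitWeight; positivity

lemma hitWeight_le_one (N : V → Finset U) (I : Finset U) (v : V) : hitWeight N I v ≤ 1 :=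
  pow_le_one₀ (by norm_num) (by norm_num)

lemma hitWeight_anti (N : V → Finset U) {I J : Finset U} (h : I ⊆ J) (v : V) :
    hitWeight N J v ≤ hitWeight N I v :=
  pow_le_pow_of_le_one (by norm_num) (by norm_num) (card_le_card (inter_subset_inter_left h))

lemma totalWeight_anti (N : V → Finset U) (X : Finset V) {I J : Finset U} (h : I ⊆ J) :
    totalWeight N X J ≤ totalWeight N X I :=
  sum_le_sum fun v _ => hitWeight_anti N h v

lemma setProb_nonneg [Fintype U] (N : V → Finset U) (I : Finset U) (S : Finset V) :
    0 ≤ setProb N I S :=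
  prod_nonneg fun _ _ => by positivity

/-- A block through `v` whose colour is already prescribed costs a factor `1/2`. A block not yet
prescribed costs nothing, but `v` now prescribes its colour, so it joins `I`. -/
lemma setProb_insert [Fintype U] [DecidableEq V] (N : V → Finset U) (I : Finset U)
    (S : Finset V) {v : V} (hv : v ∉ S) :
    setProb N I (insert v S) = hitWeight N I v * setProb N (I ∪ N v) S := by
  have h1 : hitWeight N I v = ∏ u, (1 / 2 : ℝ) ^ (if u ∈ N v ∩ I then 1 else 0) := by
    rw [hitWeight, prod_pow_eq_pow_sum, sum_boole, filter_mem_eq_inter, univ_inter, Nat.cast_id]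
  rw [h1, setProb, setProb, ← prod_mul_distrib]
  refine prod_congr rfl fun u _ => ?_
  rw [← pow_add]
  congr 1
  have hv' : v ∉ {x ∈ S | u ∈ N x} := fun h => hv (mem_filter.1 h).1
  rw [filter_insert]
  by_cases h1 : u ∈ N v <;> by_cases h2 : u ∈ I <;> simp [h1, h2, card_insert_of_notMem hv']
  omega

lemma partitionFn_insert [Fintype U] [DecidableEq V] (N : V → Finset U) (y : ℝ)
    (X : Finset V) (I : Finset U) {v : V} (hv : v ∉ X) :
    partitionFn N y (insert v X) I =
      partitionFn N y X I + y * hitWeight N I v * partitionFn N y X (I ∪ N v) := by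
  rw [partitionFn, sum_powerset_insert hv, partitionFn, partitionFn, mul_sum]
  congr 1
  refine sum_congr rfl fun S hS => ?_
  have hvS : v ∉ S := fun h => hv (mem_powerset.1 hS h)
  rw [card_insert_of_notMem hvS, setProb_insert N I S hvS]
  ring

lemma partitionFn_nonneg [Fintype U] (N : V → Finset U) {y : ℝ} (hy : 0 ≤ y) (X : Finset V) (I : Finset U) :
    0 ≤ partitionFn N y X I :=
  sum_nonneg fun S _ => mul_nonneg (by positivity) (setProb_nonneg N I S)

/-- The crude bound that ignores further hits, `Z ≤ ∏ (1 + y w(v))`; it is used once the total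
weight is small. -/
lemma partitionFn_le_exp [Fintype U] [DecidableEq V] (N : V → Finset U) {y : ℝ} (hy : 0 ≤ y)
    (X : Finset V) :
    ∀ I : Finset U, partitionFn N y X I ≤ Real.exp (y * totalWeight N X I) := by
  induction X using Finset.induction_on with
  | empty => intro I; simp [partitionFn, totalWeight, setProb]
  | insert v X hv ih =>
    intro I
    rw [partitionFn_insert N y X I hv]
    have h1 := ih I
    have h2 : partitionFn N y X (I ∪ N v) ≤ Real.exp (y * totalWeight N X I) :=
      (ih _).trans (Real.exp_le_exp.2
        (mul_le_mul_of_nonneg_left (totalWeight_anti N X subset_union_left) hy))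
    have h3 : totalWeight N (insert v X) I = hitWeight N I v + totalWeight N X I :=
      sum_insert hv
    have hw := (hitWeight_pos N I v).le
    rw [h3, mul_add, Real.exp_add]
    have h4 := Real.add_one_le_exp (y * hitWeight N I v)
    have h5 := mul_le_mul_of_nonneg_left h2 (mul_nonneg hy hw)
    nlinarith [Real.exp_pos (y * totalWeight N X I)]

/-- Distinct vertices share at most one block, and `(1/2)^k = 1 - k/2` for `k ∈ {0, 1}`; this makes
the weight loss linear in the codegree. -/
lemma hitWeight_union (N : V → Finset U) (I : Finset U)
    (hco : ∀ v w, v ≠ w → #(N v ∩ N w) ≤ 1) {x v : V} (hxv : x ≠ v) :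
    hitWeight N (I ∪ N v) x = hitWeight N I x * (1 - (#((N x ∩ N v) \ I) : ℝ) / 2) := by
  have h1 : N x ∩ (I ∪ N v) = (N x ∩ I) ∪ ((N x ∩ N v) \ I) := by
    ext u; simp only [mem_inter, mem_union, mem_sdiff]; tauto
  have h2 : Disjoint (N x ∩ I) ((N x ∩ N v) \ I) := by
    rw [disjoint_left]; intro u; simp only [mem_inter, mem_sdiff]; tauto
  have h3 : #((N x ∩ N v) \ I) ≤ 1 := (card_le_card sdiff_subset).trans (hco x v hxv)
  rw [hitWeight, hitWeight, h1, card_union_of_disjoint h2, pow_add]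
  congr 1
  interval_cases #((N x ∩ N v) \ I) <;> norm_num

lemma sum_hitWeight_codegree [Fintype U] (N : V → Finset U) (X : Finset V) (I : Finset U) :
    ∑ v ∈ X, hitWeight N I v * ∑ x ∈ X, hitWeight N I x * (#((N x ∩ N v) \ I) : ℝ) =
      ∑ u ∈ Iᶜ, (∑ x ∈ X, hitWeight N I x * (if u ∈ N x then 1 else 0)) ^ 2 := by
  have h1 : ∀ x v, (#((N x ∩ N v) \ I) : ℝ) =
      ∑ u ∈ Iᶜ, (if u ∈ N x then 1 else 0) * (if u ∈ N v then 1 else 0) := by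
    intro x v
    have : (N x ∩ N v) \ I = {u ∈ Iᶜ | u ∈ N x ∧ u ∈ N v} := by
      ext u; simp only [mem_inter, mem_sdiff, mem_filter, mem_compl]; tauto
    rw [this, card_filter]
    push_cast
    refine sum_congr rfl fun u _ => ?_
    by_cases h1 : u ∈ N x <;> by_cases h2 : u ∈ N v <;> simp [h1, h2]
  simp_rw [h1, sq, sum_mul_sum, mul_sum]
  rw [sum_comm_cycle]
  refine sum_congr rfl fun u _ => sum_congr rfl fun v _ => sum_congr rfl fun x _ => by ring

/-- If every vertex lowered the weight too little, all weighted codegrees would be small, hence so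
would the sum of squares of the weights carried by the unhit blocks. By Cauchy–Schwarz that sum is
large, since most of the weight lies on vertices with at least half their blocks unhit. -/
lemma exists_totalWeight_decrement [Fintype U] [Fintype V] [DecidableEq V]
    (N : V → Finset U) {a : ℕ} (ha : 0 < a)
    (hcard : ∀ v, #(N v) = a) (hco : ∀ v w, v ≠ w → #(N v ∩ N w) ≤ 1)
    (X : Finset V) (I : Finset U) {η : ℝ} (hη0 : 0 ≤ η)
    (hη : ∀ k : ℕ, a ≤ 2 * k → (1 / 2 : ℝ) ^ k ≤ η)
    (hU : 0 < Fintype.card U)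
    (hηW : 2 * (Fintype.card V : ℝ) * η ≤ totalWeight N X I)
    (hW : 32 * (Fintype.card U : ℝ) ≤ a * totalWeight N X I) :
    ∃ v ∈ X, totalWeight N (X.erase v) (I ∪ N v) ≤
      (1 - (a : ℝ) ^ 2 / (128 * Fintype.card U)) * totalWeight N X I := by
  set W := totalWeight N X I with hWdef
  set m : ℝ := (Fintype.card U : ℝ) with hm
  have hm0 : 0 < m := by rw [hm]; exact_mod_cast hU
  have ha0 : (0 : ℝ) < a := by exact_mod_cast ha
  have hW0 : 0 < W := by
    by_contra h
    have : (a : ℝ) * W ≤ 0 := mul_nonpos_of_nonneg_of_nonpos ha0.le (not_lt.1 h)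
    linarith
  set ρ : ℝ := (a : ℝ) ^ 2 / (128 * m) with hρ
  have hρm : ρ * m = (a : ℝ) ^ 2 / 128 := by rw [hρ]; field_simp
  by_contra hcon
  push Not at hcon
  have hdeg : ∀ v ∈ X, ∑ x ∈ X, hitWeight N I x * (#((N x ∩ N v) \ I) : ℝ) ≤ 2 * ρ * W + a := by
    intro v hv
    have h1 := hcon v hv
    have h2 : totalWeight N (X.erase v) (I ∪ N v) =
        ∑ x ∈ X.erase v, (hitWeight N I x -
          hitWeight N I x * (#((N x ∩ N v) \ I) : ℝ) / 2) := by
      refine sum_congr rfl fun x hx => ?_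
      rw [hitWeight_union N I hco (ne_of_mem_erase hx)]; ring
    rw [sum_sub_distrib, ← sum_div] at h2
    have h3 := add_sum_erase X (fun x => hitWeight N I x) hv
    have h4 := add_sum_erase X (fun x => hitWeight N I x * (#((N x ∩ N v) \ I) : ℝ)) hv
    -- The diagonal term `x = v` is not covered by `hitWeight_union`; it is the source of the
    -- summand `a`.
    have h5 : hitWeight N I v * (#((N v ∩ N v) \ I) : ℝ) ≤ 1 * a := by
      refine mul_le_mul (hitWeight_le_one N I v) ?_ (by positivity) zero_le_one
      rw [inter_self, ← hcard v]
      exact_mod_cast card_le_card sdiff_subset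
    have h6 : W = ∑ x ∈ X, hitWeight N I x := rfl
    have h7 := (hitWeight_pos N I v).le
    linarith
  have hsum_le : ∑ v ∈ X, hitWeight N I v * ∑ x ∈ X, hitWeight N I x * (#((N x ∩ N v) \ I) : ℝ) ≤
      W * (2 * ρ * W + a) := by
    rw [hWdef, totalWeight, sum_mul]
    exact sum_le_sum fun v hv => mul_le_mul_of_nonneg_left (hdeg v hv) (hitWeight_pos N I v).le
  rw [sum_hitWeight_codegree] at hsum_le
  set f : U → ℝ := fun u => ∑ x ∈ X, hitWeight N I x * (if u ∈ N x then 1 else 0) with hf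
  have hcauchy : (∑ u ∈ Iᶜ, f u) ^ 2 ≤ m * ∑ u ∈ Iᶜ, f u ^ 2 := by
    refine sq_sum_le_card_mul_sum_sq.trans ?_
    refine mul_le_mul_of_nonneg_right ?_ (sum_nonneg fun _ _ => sq_nonneg _)
    rw [hm]; exact_mod_cast card_le_univ _
  have hinc : a * W / 4 ≤ ∑ u ∈ Iᶜ, f u := by
    have h1 : ∑ u ∈ Iᶜ, f u = ∑ x ∈ X, hitWeight N I x * (#(N x \ I) : ℝ) := by
      rw [hf, sum_comm]
      refine sum_congr rfl fun x _ => ?_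
      rw [← mul_sum]
      congr 1
      have : N x \ I = {u ∈ Iᶜ | u ∈ N x} := by
        ext u; simp only [mem_sdiff, mem_filter, mem_compl]; tauto
      rw [this, card_filter]; push_cast; rfl
    -- Either at least half the blocks of `x` are unhit, or its weight is at most `η` and the left
    -- side is not positive. The total loss `|V| η` is at most `W / 2`.
    have h2 : ∀ x ∈ X, (a : ℝ) / 2 * (hitWeight N I x - η) ≤
        hitWeight N I x * (#(N x \ I) : ℝ) := by
      intro x _
      have h3 : #(N x \ I) + #(N x ∩ I) = a := by rw [card_sdiff_add_card_inter, hcard]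
      have hw := (hitWeight_pos N I x).le
      by_cases h : a ≤ 2 * #(N x ∩ I)
      · have h4 : hitWeight N I x ≤ η := hη _ h
        have h5 : (a : ℝ) / 2 * (hitWeight N I x - η) ≤ 0 :=
          mul_nonpos_of_nonneg_of_nonpos (by positivity) (by linarith)
        exact h5.trans (by positivity)
      · have h4 : a ≤ 2 * #(N x \ I) := by omega
        have h5 : (a : ℝ) ≤ 2 * (#(N x \ I) : ℝ) := by exact_mod_cast h4
        nlinarith [mul_nonneg ha0.le hη0]
    have h3 := sum_le_sum h2
    rw [← mul_sum, sum_sub_distrib, sum_const, nsmul_eq_mul] at h3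
    have h4 : (#X : ℝ) * η ≤ Fintype.card V * η :=
      mul_le_mul_of_nonneg_right (by exact_mod_cast card_le_univ _) hη0
    have h6 : W = ∑ x ∈ X, hitWeight N I x := rfl
    rw [h1]
    refine le_trans ?_ h3
    rw [← h6]
    nlinarith
  have hinc_sq : (a * W / 4) ^ 2 ≤ (∑ u ∈ Iᶜ, f u) ^ 2 := pow_le_pow_left₀ (by positivity) hinc 2
  have hsum_mul : m * ∑ u ∈ Iᶜ, f u ^ 2 ≤ m * (W * (2 * ρ * W + a)) :=
    mul_le_mul_of_nonneg_left hsum_le hm0.le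
  -- In units of `(aW)²`, the upper bound is `1/64 + 1/32`, below the lower bound `1/16`.
  have e1 : m * (W * (2 * ρ * W + a)) = 2 * (ρ * m) * W ^ 2 + m * (a * W) := by ring
  rw [e1, hρm] at hsum_mul
  have h8 : 32 * m * (a * W) ≤ (a * W) * (a * W) :=
    mul_le_mul_of_nonneg_right hW (by positivity)
  have h9 : 0 < (a * W) ^ 2 := by positivity
  nlinarith

/-- Here `k` is a budget of decrements by `exp(-ρ)` that brings the weight down to `R`. Branch on
the vertex `v` of the decrement lemma: omitting it keeps `k`, choosing it costs a factor `y` and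
lowers `k` by one. -/
lemma partitionFn_le [Fintype U] [Fintype V] [DecidableEq V]
    (N : V → Finset U) {a : ℕ} (ha : 0 < a)
    (hcard : ∀ v, #(N v) = a) (hco : ∀ v w, v ≠ w → #(N v ∩ N w) ≤ 1)
    {η R y : ℝ} (hη0 : 0 ≤ η) (hη : ∀ k : ℕ, a ≤ 2 * k → (1 / 2 : ℝ) ^ k ≤ η)
    (hU : 0 < Fintype.card U) (hηR : 2 * (Fintype.card V : ℝ) * η ≤ R)
    (hR : 32 * (Fintype.card U : ℝ) ≤ a * R) (hy : 0 ≤ y) (s : ℕ) :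
    ∀ (X : Finset V) (I : Finset U) (k : ℕ), #X = s →
      totalWeight N X I ≤ R * Real.exp ((a : ℝ) ^ 2 / (128 * Fintype.card U) * k) →
      partitionFn N y X I ≤ (1 + s * y) ^ k * Real.exp (y * R) := by
  set ρ : ℝ := (a : ℝ) ^ 2 / (128 * Fintype.card U) with hρ
  have ha0 : (0 : ℝ) < a := by exact_mod_cast ha
  have small : ∀ (X : Finset V) (I : Finset U) (k s : ℕ), totalWeight N X I ≤ R →
      partitionFn N y X I ≤ (1 + s * y) ^ k * Real.exp (y * R) := by
    intro X I k s h
    calc partitionFn N y X I ≤ Real.exp (y * totalWeight N X I) := partitionFn_le_exp N hy X I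
      _ ≤ 1 * Real.exp (y * R) := by
        rw [one_mul]; exact Real.exp_le_exp.2 (mul_le_mul_of_nonneg_left h hy)
      _ ≤ _ := mul_le_mul_of_nonneg_right
        (one_le_pow₀ (le_add_of_nonneg_right (by positivity))) (Real.exp_pos _).le
  induction s with
  | zero =>
    intro X I k hX h
    rw [card_eq_zero] at hX
    subst hX
    refine small _ _ _ _ ?_
    have : 0 ≤ R := by
      by_contra h
      have : (a : ℝ) * R ≤ 0 := mul_nonpos_of_nonneg_of_nonpos ha0.le (not_le.1 h).le
      have : (0 : ℝ) < Fintype.card U := by exact_mod_cast hU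
      linarith
    simpa [totalWeight] using this
  | succ s ih =>
    intro X I k hX h
    rcases le_or_gt (totalWeight N X I) R with hWR | hWR
    · exact small _ _ _ _ hWR
    cases k with
    | zero => simp at h; linarith
    | succ k =>
      obtain ⟨v, hv, hdec⟩ := exists_totalWeight_decrement N ha hcard hco X I hη0 hη hU
        (hηR.trans hWR.le) (hR.trans (mul_le_mul_of_nonneg_left hWR.le ha0.le))
      have hcX : #(X.erase v) = s := by rw [card_erase_of_mem hv, hX]; rfl
      have hW0 : 0 ≤ totalWeight N X I := sum_nonneg fun x _ => (hitWeight_pos N I x).le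
      have hnext : totalWeight N (X.erase v) (I ∪ N v) ≤ R * Real.exp (ρ * k) := by
        calc _ ≤ (1 - ρ) * totalWeight N X I := hdec
          _ ≤ Real.exp (-ρ) * totalWeight N X I :=
            mul_le_mul_of_nonneg_right (by linarith [Real.add_one_le_exp (-ρ)]) hW0
          _ ≤ Real.exp (-ρ) * (R * Real.exp (ρ * ((k + 1 : ℕ) : ℝ))) :=
            mul_le_mul_of_nonneg_left h (Real.exp_pos _).le
          _ = R * (Real.exp (-ρ) * Real.exp (ρ * ((k + 1 : ℕ) : ℝ))) := by ring
          _ = _ := by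
            rw [← Real.exp_add]; congr 2; push_cast; ring
      have hsub : totalWeight N (X.erase v) I ≤ totalWeight N X I :=
        sum_le_sum_of_subset_of_nonneg (erase_subset _ _) fun x _ _ => (hitWeight_pos N I x).le
      have h1 := ih (X.erase v) I (k + 1) hcX (hsub.trans h)
      have h2 := ih (X.erase v) (I ∪ N v) k hcX hnext
      have h3 := partitionFn_insert N y (X.erase v) I (notMem_erase v X)
      rw [insert_erase hv] at h3
      rw [h3]
      have h4 : y * hitWeight N I v * partitionFn N y (X.erase v) (I ∪ N v) ≤
          y * ((1 + s * y) ^ k * Real.exp (y * R)) := by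
        rw [mul_assoc]
        refine mul_le_mul_of_nonneg_left ?_ hy
        calc _ ≤ 1 * partitionFn N y (X.erase v) (I ∪ N v) :=
              mul_le_mul_of_nonneg_right (hitWeight_le_one N I v) (partitionFn_nonneg N hy _ _)
          _ ≤ _ := by rw [one_mul]; exact h2
      have hs : (0 : ℝ) ≤ s * y := by positivity
      have h5 : (1 + (s : ℝ) * y) ^ k ≤ (1 + ((s + 1 : ℕ) : ℝ) * y) ^ k :=
        pow_le_pow_left₀ (by linarith) (by push_cast; linarith) k
      calc _ ≤ (1 + s * y) ^ (k + 1) * Real.exp (y * R) +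
              y * ((1 + s * y) ^ k * Real.exp (y * R)) := add_le_add h1 h4
        _ = (1 + s * y) ^ k * ((1 + ((s + 1 : ℕ) : ℝ) * y) * Real.exp (y * R)) := by
            push_cast; ring
        _ ≤ (1 + ((s + 1 : ℕ) : ℝ) * y) ^ k * ((1 + ((s + 1 : ℕ) : ℝ) * y) * Real.exp (y * R)) :=
            mul_le_mul_of_nonneg_right h5 (by positivity)
        _ = _ := by ring

end PartitionFunction

/-! ### Random colourings and sampling a vertex subset -/

section Colouring

open Finset

/-- Two-colourings of a finite type that are constant on `T`. -/
lemma card_constOn_le {V : Type*} [Fintype V] [DecidableEq V] (T : Finset V) :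
    (#{f : V → Bool | ∀ x ∈ T, ∀ y ∈ T, f x = f y} : ℝ) ≤
      2 ^ Fintype.card V * (1 / 2) ^ (#T - 1) := by
  rcases T.eq_empty_or_nonempty with rfl | ⟨x₀, hx₀⟩
  · simp [card_univ]
  have h1 : #{f : V → Bool | ∀ x ∈ T, ∀ y ∈ T, f x = f y} ≤
      Fintype.card ({x // x ∈ (T.erase x₀)ᶜ} → Bool) := by
    rw [← card_univ]
    refine card_le_card_of_injOn (fun f x => f x) (fun _ _ => mem_coe.2 (mem_univ _)) ?_
    intro f hf g hg hfg
    simp only [coe_filter, mem_univ, true_and, Set.mem_ofPred_eq] at hf hg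
    have key : ∀ x (_ : x ∈ (T.erase x₀)ᶜ), f x = g x := fun x hx => congrFun hfg ⟨x, hx⟩
    funext x
    by_cases hx : x ∈ T
    · rw [hf x hx x₀ hx₀, hg x hx x₀ hx₀]
      exact key x₀ (by simp)
    · exact key x (by simp [hx])
  have h2 : Fintype.card ({x // x ∈ (T.erase x₀)ᶜ} → Bool) =
      2 ^ (Fintype.card V - (#T - 1)) := by
    rw [Fintype.card_fun, Fintype.card_bool, Fintype.card_coe, card_compl, card_erase_of_mem hx₀]
  have h3 : #T - 1 ≤ Fintype.card V := (Nat.sub_le _ _).trans (card_le_univ T)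
  calc (#{f : V → Bool | ∀ x ∈ T, ∀ y ∈ T, f x = f y} : ℝ)
      ≤ ((2 ^ (Fintype.card V - (#T - 1)) : ℕ) : ℝ) := by exact_mod_cast h2 ▸ h1
    _ = 2 ^ Fintype.card V * (1 / 2) ^ (#T - 1) := by
      push_cast
      rw [pow_sub₀ _ two_ne_zero h3, one_div, inv_pow]

variable {V U : Type*}

/-- Given blocks `{v | u ∈ N v}`, each with a two-colouring `χ u`, the union over all `u` of the
complete bipartite graphs between the two colour classes of the block of `u`. -/
def splitGraph (N : V → Finset U) (χ : U → V → Bool) : SimpleGraph V where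
  Adj v w := ∃ u, u ∈ N v ∧ u ∈ N w ∧ χ u v ≠ χ u w
  symm := ⟨fun _ _ ⟨u, hv, hw, h⟩ => ⟨u, hw, hv, h.symm⟩⟩
  loopless := ⟨fun _ ⟨_, _, _, h⟩ => h rfl⟩

lemma splitGraph_isIndepSet [DecidableEq U] {N : V → Finset U} {χ : U → V → Bool} {S : Finset V} :
    (splitGraph N χ).IsIndepSet S ↔
      ∀ u, ∀ x ∈ {x ∈ S | u ∈ N x}, ∀ y ∈ {x ∈ S | u ∈ N x}, χ u x = χ u y := by
  constructor
  · intro h u x hx y hy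
    rw [mem_filter] at hx hy
    by_contra hne
    exact h hx.1 hy.1 (fun e => hne (by rw [e])) ⟨u, hx.2, hy.2, hne⟩
  · rintro h x hx y hy - ⟨u, hux, huy, hne⟩
    exact hne (h u x (mem_filter.2 ⟨hx, hux⟩) y (mem_filter.2 ⟨hy, huy⟩))

open scoped Classical in
-- Independence of `S` is a separate condition on the colouring of each block, so the admissible
-- colourings form a product.
lemma card_splitGraph_indep_le [Fintype V] [Fintype U] [DecidableEq V] [DecidableEq U]
    (N : V → Finset U) (S : Finset V) :
    (#{χ : U → V → Bool | (splitGraph N χ).IsIndepSet S} : ℝ) ≤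
      Fintype.card (U → V → Bool) * setProb N ∅ S := by
  have h1 : ({χ : U → V → Bool | (splitGraph N χ).IsIndepSet S} : Finset (U → V → Bool)) =
      Fintype.piFinset fun u => {f : V → Bool | ∀ x ∈ {x ∈ S | u ∈ N x},
        ∀ y ∈ {x ∈ S | u ∈ N x}, f x = f y} := by
    ext χ
    simp only [mem_filter, mem_univ, true_and, Fintype.mem_piFinset, splitGraph_isIndepSet]
  rw [h1, Fintype.card_piFinset, Fintype.card_fun, Fintype.card_fun, Fintype.card_bool, setProb]
  push_cast
  rw [← card_univ (α := U), ← prod_const, ← prod_mul_distrib]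
  refine prod_le_prod (fun _ _ => by positivity) fun u _ => ?_
  simpa using card_constOn_le {x ∈ S | u ∈ N x}

open scoped Classical in
/-- Some choice of the colourings makes the number of independent `t`-sets at most its average. -/
lemma exists_splitGraph_card_indep_le [Fintype V] [Fintype U] [DecidableEq V] [DecidableEq U]
    (N : V → Finset U) {y : ℝ} (hy : 0 ≤ y) (t : ℕ) :
    ∃ χ : U → V → Bool,
      (#((powersetCard t univ).filter fun S : Finset V =>
        (splitGraph N χ).IsIndepSet (S : Set V)) : ℝ) * y ^ t ≤
        partitionFn N y univ ∅ := by
  have h1 : ∑ χ : U → V → Bool,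
      (#((powersetCard t univ).filter fun S : Finset V =>
        (splitGraph N χ).IsIndepSet (S : Set V)) : ℝ) * y ^ t ≤
      ∑ χ : U → V → Bool, partitionFn N y univ ∅ := by
    calc _ = ∑ S ∈ powersetCard t (univ : Finset V),
          (#{χ : U → V → Bool | (splitGraph N χ).IsIndepSet (S : Set V)} : ℝ) * y ^ t := by
          rw [← sum_mul, ← sum_mul]
          congr 1
          simp_rw [card_filter]
          push_cast
          exact sum_comm
      _ ≤ ∑ S ∈ powersetCard t (univ : Finset V),
          (Fintype.card (U → V → Bool) : ℝ) * (y ^ #S * setProb N ∅ S) := by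
          refine sum_le_sum fun S hS => ?_
          have hSt : #S = t := (mem_powersetCard.1 hS).2
          calc _ ≤ _ := mul_le_mul_of_nonneg_right (card_splitGraph_indep_le N S) (by positivity)
            _ = _ := by rw [hSt]; ring
      _ ≤ _ := by
          rw [← mul_sum, sum_const, nsmul_eq_mul, card_univ]
          refine mul_le_mul_of_nonneg_left ?_ (by positivity)
          refine sum_le_sum_of_subset_of_nonneg ?_ fun S _ _ =>
            mul_nonneg (by positivity) (setProb_nonneg N ∅ S)
          exact fun S _ => mem_powerset.2 (subset_univ S)
  obtain ⟨χ, _, h⟩ := exists_le_of_sum_le univ_nonempty h1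
  exact ⟨χ, h⟩

/-- A random `M`-set contains a given `t`-set with probability at most `(M/n)^t`, because `(M -
i)/(n - i) ≤ M/n`. -/
lemma choose_mul_pow_le {M n : ℕ} (h : M ≤ n) (t : ℕ) :
    M.choose t * n ^ t ≤ n.choose t * M ^ t := by
  have key : ∀ t, M.descFactorial t * n ^ t ≤ n.descFactorial t * M ^ t := by
    intro t
    induction t with
    | zero => simp
    | succ t ih =>
      rw [Nat.descFactorial_succ, Nat.descFactorial_succ, pow_succ, pow_succ]
      have h2 : (M - t) * n ≤ (n - t) * M := by
        rw [Nat.sub_mul, Nat.sub_mul, Nat.mul_comm n M]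
        exact Nat.sub_le_sub_left (Nat.mul_le_mul_left t h) _
      calc _ = ((M - t) * n) * (M.descFactorial t * n ^ t) := by ring
        _ ≤ ((n - t) * M) * (n.descFactorial t * M ^ t) := Nat.mul_le_mul h2 ih
        _ = _ := by ring
  have h3 := key t
  rw [Nat.descFactorial_eq_factorial_mul_choose, Nat.descFactorial_eq_factorial_mul_choose,
    mul_assoc, mul_assoc] at h3
  exact Nat.le_of_mul_le_mul_left h3 (Nat.factorial_pos t)

/-- If a family of `t`-sets is sparse, some `M`-set contains no member of it. -/
lemma exists_card_eq_forall_not_subset [Fintype V] [DecidableEq V] {t M : ℕ}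
    (F : Finset (Finset V)) (hF : ∀ S ∈ F, #S = t) (hM : M ≤ Fintype.card V)
    (hlt : #F * M ^ t < Fintype.card V ^ t) :
    ∃ X : Finset V, #X = M ∧ ∀ S ∈ F, ¬ S ⊆ X := by
  by_contra hcon
  push Not at hcon
  set n := Fintype.card V with hn
  rcases lt_or_ge n t with htn | htn
  · obtain ⟨X, -, hX⟩ := exists_subset_card_eq (s := (univ : Finset V)) (n := M) (by simpa using hM)
    obtain ⟨S, hS, -⟩ := hcon X hX
    have := hF S hS ▸ card_le_univ S
    omega
  -- Union bound: each member of `F` lies in `(n - t).choose (M - t)` of the `M`-sets, and these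
  -- would have to cover all `M`-sets.
  have h1 : n.choose M ≤ #F * (n - t).choose (M - t) := by
    calc n.choose M = #(powersetCard M (univ : Finset V)) := by rw [card_powersetCard, card_univ]
      _ ≤ #(F.biUnion fun S => {X ∈ powersetCard M (univ : Finset V) | S ⊆ X}) := by
        refine card_le_card fun X hX => ?_
        obtain ⟨S, hS, hSX⟩ := hcon X (mem_powersetCard.1 hX).2
        exact mem_biUnion.2 ⟨S, hS, mem_filter.2 ⟨hX, hSX⟩⟩
      _ ≤ #F * (n - t).choose (M - t) := by
        refine card_biUnion_le_card_mul _ _ _ fun S hS => ?_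
        have h2 : #(powersetCard (M - t) (univ \ S)) = (n - t).choose (M - t) := by
          rw [card_powersetCard, card_univ_sdiff, hF S hS]
        rw [← h2]
        refine card_le_card_of_injOn (fun X => X \ S) ?_ ?_
        · intro X hX
          rw [mem_coe, mem_filter, mem_powersetCard] at hX
          rw [mem_coe, mem_powersetCard, card_sdiff_of_subset hX.2, hX.1.2, hF S hS]
          exact ⟨sdiff_subset_sdiff (subset_univ _) subset_rfl, rfl⟩
        · intro X hX Y hY hXY
          rw [mem_coe, mem_filter] at hX hY
          have e : X \ S = Y \ S := hXY
          rw [← sdiff_union_of_subset hX.2, ← sdiff_union_of_subset hY.2, e]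
  rcases lt_or_ge M t with htM | htM
  · obtain ⟨X, -, hX⟩ := exists_subset_card_eq (s := (univ : Finset V)) (n := M) (by simpa using hM)
    obtain ⟨S, hS, hSX⟩ := hcon X hX
    have := hF S hS ▸ card_le_card hSX
    omega
  have h2 := Nat.choose_mul (n := n) htM
  have h3 : 0 < (n - t).choose (M - t) := Nat.choose_pos (by omega)
  have h4 : 0 < n.choose t := Nat.choose_pos htn
  have h5 : n.choose t ≤ #F * M.choose t := by
    refine Nat.le_of_mul_le_mul_right ?_ h3
    rw [← h2]
    calc _ ≤ #F * (n - t).choose (M - t) * M.choose t := Nat.mul_le_mul_right _ h1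
      _ = _ := by ring
  have h6 := choose_mul_pow_le hM t
  have h7 : n.choose t * n ^ t ≤ n.choose t * (#F * M ^ t) := by
    calc _ ≤ #F * M.choose t * n ^ t := Nat.mul_le_mul_right _ h5
      _ = #F * (M.choose t * n ^ t) := by ring
      _ ≤ #F * (n.choose t * M ^ t) := Nat.mul_le_mul_left _ h6
      _ = _ := by ring
  have := Nat.le_of_mul_le_mul_left h7 h4
  omega

open scoped Classical in
/-- A choice of colourings and an `M`-set spanning no independent `t`-set. -/
lemma exists_splitGraph_no_indep [Fintype V] [Fintype U] [DecidableEq V] [DecidableEq U]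
    (N : V → Finset U) {y : ℝ} (hy : 0 < y)
    {t M : ℕ} (hM : M ≤ Fintype.card V)
    (hlt : partitionFn N y univ ∅ * (M : ℝ) ^ t < (y * Fintype.card V) ^ t) :
    ∃ χ : U → V → Bool, ∃ X : Finset V, #X = M ∧
      ∀ S ⊆ X, #S = t → ¬ (splitGraph N χ).IsIndepSet S := by
  obtain ⟨χ, hχ⟩ := exists_splitGraph_card_indep_le N hy.le t
  refine ⟨χ, ?_⟩
  set F : Finset (Finset V) := (powersetCard t univ).filter fun S : Finset V =>
    (splitGraph N χ).IsIndepSet S with hF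
  obtain ⟨X, hX, h⟩ := exists_card_eq_forall_not_subset (t := t) (M := M) F
    (fun S hS => (mem_powersetCard.1 (mem_filter.1 hS).1).2) hM (by
      have hy' : 0 < y ^ t := by positivity
      have h1 : (#F : ℝ) * (M : ℝ) ^ t * y ^ t < (Fintype.card V : ℝ) ^ t * y ^ t := by
        calc _ = (#F : ℝ) * y ^ t * (M : ℝ) ^ t := by ring
          _ ≤ partitionFn N y univ ∅ * (M : ℝ) ^ t :=
            mul_le_mul_of_nonneg_right hχ (by positivity)
          _ < _ := hlt
          _ = _ := by rw [mul_pow]; ring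
      exact_mod_cast lt_of_mul_lt_mul_right h1 hy'.le)
  refine ⟨X, hX, fun S hSX hS hind => h S ?_ hSX⟩
  exact mem_filter.2 ⟨mem_powersetCard.2 ⟨subset_univ _, hS⟩, hind⟩

end Colouring

/-! ### Consequences of large girth -/

section Girth

open SimpleGraph

/-- Shortening the walk to a path adds no edge, so closing it with `s(x, y)` gives a cycle. Repeated
vertices in the walk are harmless. -/
lemma egirth_le_of_walk {W : Type*} {G : SimpleGraph W} {x y : W} (h : G.Adj x y)
    (p : G.Walk y x) (hp : s(x, y) ∉ p.edges) : G.egirth ≤ (p.length + 1 : ℕ) := by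
  classical
  have hc : (Walk.cons h p.bypass).IsCycle :=
    (Walk.cons_isCycle_iff _ _).2 ⟨p.bypass_isPath, fun hh => hp (p.edges_bypass_subset_edges hh)⟩
  refine (egirth_le_length hc).trans ?_
  rw [Walk.length_cons]
  exact_mod_cast Nat.succ_le_succ p.length_bypass_le_length

variable {V U : Type*}

/-- A cyclic sequence `v 0, u 0, v 1, u 1, …` of incidences, with `v 0, …, v (k + 1)` distinct, in a
graph of girth larger than `2 (k + 2)`, has all its `u i` equal. -/
lemma eq_of_cyclic_incidence {G : SimpleGraph (U ⊕ V)} {k : ℕ}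
    (hg : ((2 * (k + 2) : ℕ) : ℕ∞) < G.egirth) (v : ℕ → V) (u : ℕ → U)
    (hv : ∀ i, v (i + (k + 2)) = v i) (hinj : ∀ i j, 0 < j → j < k + 2 → v (i + j) ≠ v i)
    (h1 : ∀ i, G.Adj (Sum.inl (u i)) (Sum.inr (v i)))
    (h2 : ∀ i, G.Adj (Sum.inl (u i)) (Sum.inr (v (i + 1)))) (i : ℕ) :
    u (i + (k + 1)) = u i := by
  by_contra hne
  -- The walk `u i, v (i+1), u (i+1), …` avoids `v i`, hence the edge from `v i` to `u i`. Its
  -- closing edge at `v i` differs from that edge exactly when `u (i+k+1) ≠ u i`; the cycle then has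
  -- length at most `2(k+2)`.
  have hwalk : ∀ j, j < k + 1 → ∃ p : G.Walk (Sum.inl (u i)) (Sum.inr (v (i + (j + 1)))),
      p.length = 2 * j + 1 ∧ Sum.inr (v i) ∉ p.support := by
    intro j
    induction j with
    | zero =>
      intro hj
      refine ⟨Walk.cons (h2 i) Walk.nil, by simp, ?_⟩
      simpa using (hinj i 1 one_pos (by omega)).symm
    | succ j ih =>
      intro hj
      obtain ⟨p, hp, hs⟩ := ih (by omega)
      refine ⟨(p.concat (h1 (i + (j + 1))).symm).concat (h2 (i + (j + 1))), ?_, ?_⟩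
      · simp only [Walk.length_concat, hp]; ring
      · simp only [Walk.support_concat, List.mem_append,
          List.mem_singleton, reduceCtorEq, or_false, Sum.inr.injEq, not_or]
        exact ⟨hs, (hinj i (j + 1 + 1) (by omega) (by omega)).symm⟩
  obtain ⟨p, hp, hs⟩ := hwalk k (by omega)
  have hlast : G.Adj (Sum.inl (u (i + (k + 1)))) (Sum.inr (v i)) := by
    have := h2 (i + (k + 1))
    rwa [add_assoc, hv] at this
  have hq := egirth_le_of_walk (h1 i).symm
    ((p.concat (h1 (i + (k + 1))).symm).concat hlast) (by
      simp only [Walk.edges_concat, List.concat_eq_append, List.mem_append, List.mem_singleton,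
        not_or]
      refine ⟨⟨fun h => hs (Walk.fst_mem_support_of_mem_edges _ h), ?_⟩, ?_⟩
      · simp [(hinj i (k + 1) (by omega) (by omega)).symm]
      · simpa using Ne.symm hne)
  refine absurd (hg.trans_le hq) ?_
  simp only [Walk.length_concat, hp, not_lt]
  exact_mod_cast (by omega : 2 * k + 1 + 1 + 1 + 1 ≤ 2 * (k + 2))

open scoped Fin.CommRing in
/-- In a bipartite incidence graph of girth larger than `4 ℓ + 2`, the graph `splitGraph N χ`
contains no cycle of length `2 ℓ + 1`. -/
lemma splitGraph_free [DecidableEq U] {G : SimpleGraph (U ⊕ V)} {ℓ : ℕ} (hℓ : 1 ≤ ℓ)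
    (hg : ((4 * ℓ + 2 : ℕ) : ℕ∞) < G.egirth) (N : V → Finset U)
    (hN : ∀ v, ∀ u ∈ N v, G.Adj (Sum.inl u) (Sum.inr v)) (χ : U → V → Bool) :
    (cycleGraph (2 * ℓ + 1)).Free (splitGraph N χ) := by
  rintro ⟨f⟩
  obtain ⟨l, rfl⟩ : ∃ l, ℓ = l + 1 := ⟨ℓ - 1, by omega⟩
  change Copy (cycleGraph (2 * l + 1 + 2)) _ at f
  have hadj : ∀ x, (splitGraph N χ).Adj (f x) (f (x + 1)) := by
    intro x
    refine f.toHom.map_adj ?_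
    rw [cycleGraph_adj]
    right
    ring
  choose u hu1 hu2 hu3 using hadj
  have hper : ∀ i : ℕ, ((i + (2 * l + 1 + 2) : ℕ) : Fin (2 * l + 1 + 2)) = i := by
    intro i
    rw [Nat.cast_add, Fin.natCast_self, add_zero]
  have hstep := eq_of_cyclic_incidence (G := G) (k := 2 * l + 1)
    (by convert hg using 3; ring) (fun i : ℕ => f (i : Fin (2 * l + 1 + 2)))
    (fun i : ℕ => u (i : Fin (2 * l + 1 + 2))) (fun i => by rw [hper i]) (by
      intro i j hj hjk h
      have h' := f.injective h
      rw [Nat.cast_add, add_eq_left, Fin.natCast_eq_zero] at h'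
      exact absurd (Nat.le_of_dvd hj h') (by omega))
    (fun i => hN _ _ (hu1 i)) (fun i => by
      have := hN _ _ (hu2 i)
      rwa [← Nat.cast_succ] at this)
  -- The shift in `hstep` is one less than the period, so it identifies consecutive blocks.
  have hconst : ∀ i : ℕ, u i = u 0 := by
    intro i
    induction i with
    | zero => simp
    | succ i ih =>
      have h := hstep (i + 1)
      rw [show i + 1 + (2 * l + 1 + 1) = i + (2 * l + 1 + 2) by ring, hper, ih] at h
      exact h.symm
  have halt : ∀ i : ℕ, χ (u 0) (f ((i + 1 : ℕ) : Fin (2 * l + 1 + 2))) =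
      !χ (u 0) (f (i : Fin (2 * l + 1 + 2))) := by
    intro i
    have h := hu3 i
    rw [hconst, ← Nat.cast_succ] at h
    exact Bool.eq_not_of_ne h.symm
  have heven : ∀ i : ℕ, χ (u 0) (f ((2 * i : ℕ) : Fin (2 * l + 1 + 2))) =
      χ (u 0) (f ((0 : ℕ) : Fin (2 * l + 1 + 2))) := by
    intro i
    induction i with
    | zero => rfl
    | succ i ih => rw [show 2 * (i + 1) = 2 * i + 1 + 1 by ring, halt, halt, Bool.not_not, ih]
  have h1 := halt (2 * (l + 1))
  rw [heven, show 2 * (l + 1) + 1 = 0 + (2 * l + 1 + 2) by ring, hper] at h1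
  exact absurd h1 (by simp)

variable [DecidableEq U]

lemma card_inter_le_one_of_egirth {G : SimpleGraph (U ⊕ V)}
    (hg : ((4 : ℕ) : ℕ∞) < G.egirth) (N : V → Finset U)
    (hN : ∀ v, ∀ u ∈ N v, G.Adj (Sum.inl u) (Sum.inr v)) {v w : V} (hvw : v ≠ w) :
    (N v ∩ N w).card ≤ 1 := by
  rw [Finset.card_le_one]
  intro x hx y hy
  rw [Finset.mem_inter] at hx hy
  by_contra hxy
  have h := egirth_le_of_walk (hN v x hx.1) (Walk.cons (hN v y hy.1).symm
    (Walk.cons (hN w y hy.2) (Walk.cons (hN w x hx.2).symm Walk.nil)))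
    (by simp [hxy, hvw])
  exact absurd (hg.trans_le h) (by simp)

/-- Counting walks of length three from a fixed point in a graph of girth larger than six. -/
lemma card_mul_le_of_egirth [Fintype V] [DecidableEq V] {G : SimpleGraph (U ⊕ V)}
    (hg : ((6 : ℕ) : ℕ∞) < G.egirth) (N : V → Finset U) (M : U → Finset V)
    (hN : ∀ v, ∀ u ∈ N v, G.Adj (Sum.inl u) (Sum.inr v)) (hM : ∀ u v, v ∈ M u ↔ u ∈ N v)
    {a b : ℕ} (ha : ∀ v, (N v).card = a) (hb : ∀ u, (M u).card = b) (u₀ : U) :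
    b * ((a - 1) * (b - 1)) ≤ Fintype.card V := by
  have hg4 : ((4 : ℕ) : ℕ∞) < G.egirth := lt_trans (by norm_num) hg
  have hco : ∀ {v w x y}, x ∈ N v → x ∈ N w → y ∈ N v → y ∈ N w → x ≠ y → v = w := by
    intro v w x y h1 h2 h3 h4 hxy
    by_contra hvw
    exact hxy (Finset.card_le_one.1 (card_inter_le_one_of_egirth hg4 N hN hvw) x
      (Finset.mem_inter.2 ⟨h1, h2⟩) y (Finset.mem_inter.2 ⟨h3, h4⟩))
  set T : Finset (Σ _ : V, Σ _ : U, V) := (M u₀).sigma fun v =>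
    ((N v).erase u₀).sigma fun u => (M u).erase v with hT
  have hcard : T.card = b * ((a - 1) * (b - 1)) := by
    rw [hT, Finset.card_sigma, Finset.sum_const_nat (m := (a - 1) * (b - 1)), hb]
    intro v hv
    rw [Finset.card_sigma, Finset.sum_const_nat (m := b - 1),
      Finset.card_erase_of_mem ((hM _ _).1 hv), ha]
    intro u hu
    rw [Finset.card_erase_of_mem ((hM _ _).2 (Finset.mem_of_mem_erase hu)), hb]
  rw [← hcard, ← Finset.card_univ]
  refine Finset.card_le_card_of_injOn (fun p => p.2.2) (fun _ _ => Finset.mem_coe.2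
    (Finset.mem_univ _)) ?_
  rintro ⟨v, u, z⟩ h ⟨w, x, z'⟩ h' hz
  obtain rfl : z = z' := hz
  simp only [hT, Finset.coe_sigma, Set.mem_sigma_iff, Finset.mem_coe, Finset.mem_erase, hM] at h h'
  obtain ⟨h1, ⟨h2, h3⟩, h4, h5⟩ := h
  obtain ⟨k1, ⟨k2, k3⟩, k4, k5⟩ := h'
  -- Two different walks from `u₀` to `z` close up to a 4-cycle if they share `v` or `u`, and to a
  -- 6-cycle otherwise.
  by_cases hvw : v = w
  · subst hvw
    by_cases hux : u = x
    · subst hux; rfl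
    · exact absurd (hco h5 h3 k5 k3 hux) h4
  by_cases hux : u = x
  · subst hux
    exact absurd (hco h1 k1 h3 k3 (Ne.symm h2)) hvw
  have h := egirth_le_of_walk (hN v u₀ h1) (Walk.cons (hN v u h3).symm
    (Walk.cons (hN z u h5) (Walk.cons (hN z x k5).symm
      (Walk.cons (hN w x k3) (Walk.cons (hN w u₀ k1).symm Walk.nil)))))
    (by simp [h2.symm, k2.symm, h4.symm, hvw])
  exact absurd (hg.trans_le h) (by simp)

end Girth

/-! ### Ramsey numbers as infima -/

section Ramsey

open SimpleGraph Finset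

/-- Ramsey's theorem for graphs. -/
lemma exists_clique_or_indepSet (r : ℕ) : ∀ s t : ℕ, s + t = r →
    ∃ M : ℕ, ∀ {V : Type} (H : SimpleGraph V) (X : Finset V), M ≤ #X →
      (∃ S ⊆ X, H.IsNClique s S) ∨ (∃ S ⊆ X, H.IsNIndepSet t S) := by
  induction r with
  | zero =>
    intro s t hst
    obtain rfl : s = 0 := by omega
    exact ⟨0, fun H X _ => Or.inl ⟨∅, empty_subset X, by simp⟩⟩
  | succ r ih =>
    intro s t hst
    rcases s with _ | s
    · exact ⟨0, fun H X _ => Or.inl ⟨∅, empty_subset X, by simp⟩⟩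
    rcases t with _ | t
    · exact ⟨0, fun H X _ => Or.inr ⟨∅, empty_subset X, by simp [isNIndepSet_iff]⟩⟩
    obtain ⟨A, hA⟩ := ih s (t + 1) (by omega)
    obtain ⟨B, hB⟩ := ih (s + 1) t (by omega)
    refine ⟨A + B + 1, fun {V} H X hX => ?_⟩
    classical
    obtain ⟨v, hv⟩ : X.Nonempty := card_pos.1 (by omega)
    have hsplit := card_filter_add_card_filter_not (s := X.erase v) (fun x => H.Adj v x)
    rw [card_erase_of_mem hv] at hsplit
    have hcase : A ≤ #{x ∈ X.erase v | H.Adj v x} ∨ B ≤ #{x ∈ X.erase v | ¬ H.Adj v x} := by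
      omega
    have hsub : ∀ S ⊆ X.erase v, insert v S ⊆ X :=
      fun S hS => insert_subset hv (hS.trans (erase_subset _ _))
    rcases hcase with h | h
    · rcases hA H _ h with ⟨S, hS, hc⟩ | ⟨S, hS, hc⟩
      · refine Or.inl ⟨insert v S, hsub S (hS.trans (filter_subset _ _)), hc.insert fun x hx => ?_⟩
        exact (mem_filter.1 (hS hx)).2
      · exact Or.inr ⟨S, (hS.trans (filter_subset _ _)).trans (erase_subset _ _), hc⟩
    · rcases hB H _ h with ⟨S, hS, hc⟩ | ⟨S, hS, hc⟩
      · exact Or.inl ⟨S, (hS.trans (filter_subset _ _)).trans (erase_subset _ _), hc⟩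
      · refine Or.inr ⟨insert v S, hsub S (hS.trans (filter_subset _ _)), ?_⟩
        rw [← isNClique_compl] at hc ⊢
        refine hc.insert fun x hx => ?_
        have := mem_filter.1 (hS hx)
        exact ⟨(ne_of_mem_erase this.1).symm, this.2⟩

/-- A graph without copies of `F` and without independent sets of order `t` bounds `r(F, t)`. -/
lemma lt_ramseyNumber {W : Type*} [Finite W] {F : SimpleGraph W} {t M : ℕ}
    (H : SimpleGraph (Fin M)) (hF : F.Free H) (hH : ∀ s, ¬ H.IsNIndepSet t s) :
    M < ramseyNumber F t := by
  classical
  -- The infimum of an empty set would be `0`, so finiteness of the Ramsey number is really needed.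
  have hne : {N : ℕ | ∀ H : SimpleGraph (Fin N), F.Free H →
      ∃ s : Finset (Fin N), H.IsNIndepSet t s}.Nonempty := by
    have := Fintype.ofFinite W
    obtain ⟨N, hN⟩ := exists_clique_or_indepSet _ (Fintype.card W) t rfl
    refine ⟨N, fun H hfree => ?_⟩
    rcases hN H univ (by simp) with ⟨S, -, hS⟩ | ⟨S, -, hS⟩
    · exfalso
      refine hfree ?_
      have e : W ≃ S := Fintype.equivOfCardEq (by rw [Fintype.card_coe, hS.card_eq])
      refine ⟨⟨⟨fun w => e w, fun {x y} hxy => ?_⟩, fun x y hxy => ?_⟩⟩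
      · exact hS.isClique (e x).2 (e y).2 fun h => hxy.ne (e.injective (Subtype.ext h))
      · exact e.injective (Subtype.ext hxy)
    · exact ⟨S, hS⟩
  by_contra hlt
  rw [not_lt] at hlt
  have hmem := Nat.sInf_mem hne
  set r := sInf {N : ℕ | ∀ H : SimpleGraph (Fin N), F.Free H →
      ∃ s : Finset (Fin N), H.IsNIndepSet t s} with hr
  have hrM : r ≤ M := hlt
  let φ : Fin r ↪ Fin M := Fin.castLEEmb hrM
  obtain ⟨s, hs⟩ := hmem (H.comap φ) fun ⟨f⟩ =>
    hF ⟨(SimpleGraph.Embedding.comap φ H).toCopy.comp f⟩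
  refine hH (s.map φ) ⟨?_, by rw [card_map, hs.card_eq]⟩
  intro x hx y hy hxy
  simp only [coe_map, Set.mem_image, mem_coe] at hx hy
  obtain ⟨x, hx, rfl⟩ := hx
  obtain ⟨y, hy, rfl⟩ := hy
  exact hs.isIndepSet hx hy fun h => hxy (by rw [h])

/-- The edgeless graph on `t - 1` vertices is a witness as soon as `F` has an edge. -/
lemma le_ramseyNumber {W : Type*} [Finite W] {F : SimpleGraph W} (hF : F ≠ ⊥) (t : ℕ) :
    t ≤ ramseyNumber F t := by
  rcases t with _ | t
  · exact Nat.zero_le _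
  refine lt_ramseyNumber (M := t) ⊥ ?_ ?_
  · rintro ⟨f⟩
    refine hF (eq_bot_iff_forall_not_adj.2 fun x y h => ?_)
    exact f.toHom.map_adj h
  · intro s hs
    have := card_le_univ s
    rw [hs.card_eq, Fintype.card_fin] at this
    omega

end Ramsey

/-! ### From an incidence graph to a Ramsey lower bound -/

section Incidence

open SimpleGraph Finset

variable {m n a b : ℕ} {G : SimpleGraph (Fin m ⊕ Fin n)}

open scoped Classical in
/-- The neighbourhood in `Fin m` of a vertex of `Fin n`. -/
noncomputable def leftNeighbors (G : SimpleGraph (Fin m ⊕ Fin n)) (v : Fin n) : Finset (Fin m) :=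
  {u | G.Adj (Sum.inl u) (Sum.inr v)}

open scoped Classical in
/-- The neighbourhood in `Fin n` of a vertex of `Fin m`. -/
noncomputable def rightNeighbors (G : SimpleGraph (Fin m ⊕ Fin n)) (u : Fin m) : Finset (Fin n) :=
  {v | G.Adj (Sum.inl u) (Sum.inr v)}

lemma mem_leftNeighbors {u : Fin m} {v : Fin n} :
    u ∈ leftNeighbors G v ↔ G.Adj (Sum.inl u) (Sum.inr v) := by
  simp [leftNeighbors]

lemma mem_rightNeighbors {u : Fin m} {v : Fin n} :
    v ∈ rightNeighbors G u ↔ G.Adj (Sum.inl u) (Sum.inr v) := by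
  simp [rightNeighbors]

lemma IsMNABGraph.card_leftNeighbors (h : IsMNABGraph m n a b G) (v : Fin n) :
    #(leftNeighbors G v) = a := by
  rw [← h.degree_right v, ← Set.ncard_coe_finset,
    ← Set.ncard_image_of_injective _ (Sum.inl_injective (β := Fin n))]
  congr 1
  ext x
  rcases x with u | w
  · simp [mem_leftNeighbors, G.adj_comm]
  · simp [h.not_adj_right]

lemma IsMNABGraph.card_rightNeighbors (h : IsMNABGraph m n a b G) (u : Fin m) :
    #(rightNeighbors G u) = b := by
  rw [← h.degree_left u, ← Set.ncard_coe_finset,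
    ← Set.ncard_image_of_injective _ (Sum.inr_injective (α := Fin m))]
  congr 1
  ext x
  rcases x with w | v
  · simp [h.not_adj_left]
  · simp [mem_rightNeighbors]

lemma IsMNABGraph.double_count (h : IsMNABGraph m n a b G) : n * a = m * b := by
  classical
  have := sum_card_bipartiteAbove_eq_sum_card_bipartiteBelow
    (s := (univ : Finset (Fin m))) (t := (univ : Finset (Fin n)))
    (fun u v => G.Adj (Sum.inl u) (Sum.inr v))
  have h1 : ∀ u, #(bipartiteAbove (fun (u : Fin m) (v : Fin n) => G.Adj (Sum.inl u) (Sum.inr v))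
      univ u) = b := fun u => by
    rw [← h.card_rightNeighbors u]; congr 1
  have h2 : ∀ v, #(bipartiteBelow (fun (u : Fin m) (v : Fin n) => G.Adj (Sum.inl u) (Sum.inr v))
      univ v) = a := fun v => by
    rw [← h.card_leftNeighbors v]; congr 1
  simp only [h1, h2, sum_const, card_univ, Fintype.card_fin, smul_eq_mul] at this
  exact this.symm

lemma IsMNABGraph.ncard_edgeSet_le (h : IsMNABGraph m n a b G) : G.edgeSet.ncard ≤ n * a := by
  classical
  have h1 : G.edgeSet ⊆ (((univ : Finset (Fin n)).sigma fun v => leftNeighbors G v).image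
      fun p => s(Sum.inl p.2, Sum.inr p.1) : Finset (Sym2 (Fin m ⊕ Fin n))) := by
    intro e he
    induction e using Sym2.ind with
    | _ x y =>
      rw [mem_edgeSet] at he
      rw [mem_coe, mem_image]
      rcases x with u | v <;> rcases y with u' | v'
      · exact absurd he (h.not_adj_left _ _)
      · exact ⟨⟨v', u⟩, by simpa [mem_leftNeighbors] using he, rfl⟩
      · exact ⟨⟨v, u'⟩, by simpa [mem_leftNeighbors] using he.symm, Sym2.eq_swap⟩
      · exact absurd he (h.not_adj_right _ _)
  refine (Set.ncard_le_ncard h1).trans ?_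
  rw [Set.ncard_coe_finset]
  refine card_image_le.trans ?_
  rw [card_sigma]
  simp [h.card_leftNeighbors]

/-- Walks of length three give `ab² ≤ 4n`; then `na = mb` yields `a²b ≤ 4m`. This keeps `m/a²` at
least `a/4`, so rounding is harmless and `t` is at least `a`. -/
lemma IsMNABGraph.cube_le (h : IsMNABGraph m n a b G) (hg : ((6 : ℕ) : ℕ∞) < G.egirth)
    (ha : 2 ≤ a) (hn : 0 < n) : a ^ 3 ≤ 4 * m := by
  have hb : 2 ≤ b := ha.trans h.a_le_b
  have hm : 0 < m := by
    rcases Nat.eq_zero_or_pos m with rfl | h0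
    · have := h.double_count
      have : 0 < n * a := by positivity
      omega
    · exact h0
  have h1 := card_mul_le_of_egirth hg (leftNeighbors G) (rightNeighbors G)
    (fun v u hu => mem_leftNeighbors.1 hu)
    (fun u v => by rw [mem_leftNeighbors, mem_rightNeighbors])
    h.card_leftNeighbors h.card_rightNeighbors (⟨0, hm⟩ : Fin m)
  rw [Fintype.card_fin] at h1
  have h2 : a * b ≤ 4 * ((a - 1) * (b - 1)) := by
    obtain ⟨a', rfl⟩ : ∃ a', a = a' + 2 := ⟨a - 2, by omega⟩
    obtain ⟨b', rfl⟩ : ∃ b', b = b' + 2 := ⟨b - 2, by omega⟩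
    rw [show a' + 2 - 1 = a' + 1 by omega, show b' + 2 - 1 = b' + 1 by omega]
    nlinarith
  have h3 : b * (a * b) ≤ 4 * n := by nlinarith
  have h4 : (a * a * b) * b ≤ (4 * m) * b := by
    calc _ = a * (b * (a * b)) := by ring
      _ ≤ a * (4 * n) := Nat.mul_le_mul_left a h3
      _ = 4 * (n * a) := by ring
      _ = _ := by rw [h.double_count]; ring
  have h5 := Nat.le_of_mul_le_mul_right h4 (by omega)
  calc a ^ 3 = a * a * a := by ring
    _ ≤ a * a * b := Nat.mul_le_mul_left _ h.a_le_b
    _ ≤ _ := h5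

/-- Makes `η = 1/n` admissible in the decrement lemma. -/
lemma half_pow_le_inv {a n k : ℕ} (hn : 0 < n) (ha : 4 * Real.log n ≤ a) (hk : a ≤ 2 * k) :
    (1 / 2 : ℝ) ^ k ≤ 1 / n := by
  have hn' : (0 : ℝ) < n := by exact_mod_cast hn
  have hk' : (a : ℝ) ≤ 2 * k := by exact_mod_cast hk
  rw [one_div, one_div, inv_pow]
  refine inv_anti₀ hn' ?_
  rw [← Real.log_le_log_iff hn' (by positivity), Real.log_pow]
  have := Real.log_two_gt_d9
  have hk0 : (0 : ℝ) ≤ k := by positivity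
  nlinarith

/-- The value of `y` balances the two factors of `partitionFn_le`: with `R = 32m/a`, both `yR` and
`L log(1 + ny)` are of order at most `(m/a²) log² n`. -/
lemma IsMNABGraph.partitionFn_le_exp (h : IsMNABGraph m n a b G)
    (hg : ((6 : ℕ) : ℕ∞) < G.egirth) (hn : 2 ≤ n) (ha : 2 ≤ a)
    (ha1 : 4 * Real.log n ≤ a) (ha2 : Real.log n ^ 2 ≤ a) :
    partitionFn (leftNeighbors G) (Real.log n ^ 2 / a) univ ∅ ≤
      Real.exp (300 * ((m : ℝ) / a ^ 2) * Real.log n ^ 2) := by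
  have hcube : (a : ℝ) ^ 3 ≤ 4 * m := by exact_mod_cast h.cube_le hg ha (by omega)
  have hco : ∀ v w, v ≠ w → #(leftNeighbors G v ∩ leftNeighbors G w) ≤ 1 := fun v w hvw =>
    card_inter_le_one_of_egirth (lt_trans (by norm_num) hg) _
      (fun _ _ => mem_leftNeighbors.1) hvw
  have hn' : (2 : ℝ) ≤ n := by exact_mod_cast hn
  have ha' : (2 : ℝ) ≤ a := by exact_mod_cast ha
  have hm' : (a : ℝ) ≤ 2 * m := by
    nlinarith [mul_nonneg (mul_nonneg (by linarith : (0 : ℝ) ≤ a) (sub_nonneg.2 ha'))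
      (by linarith : (0 : ℝ) ≤ a + 2)]
  have hm0 : 0 < (m : ℝ) := by linarith
  set lam := Real.log n with hlam
  have hlam0 : 1 / 2 < lam := by
    have := Real.log_le_log (by norm_num) hn'
    linarith [Real.log_two_gt_d9]
  have hlamexp : Real.exp lam = n := Real.exp_log (by linarith)
  set q : ℝ := (m : ℝ) / a ^ 2 with hq
  have hq0 : 1 / 2 ≤ q := by
    rw [hq, le_div_iff₀ (by positivity)]; nlinarith
  set y : ℝ := lam ^ 2 / a with hy
  have hy0 : 0 < y := by positivity
  have hy1 : y ≤ 1 := by rw [hy, div_le_one (by linarith)]; exact ha2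
  set R : ℝ := 32 * m / a with hR
  have hR1 : 2 ≤ R := by rw [hR, le_div_iff₀ (by linarith)]; linarith
  -- The initial weight is at most `n = exp lam`, and each decrement gains `a²/(128m) = 1/(128q)` in
  -- the exponent.
  set L : ℕ := ⌈128 * q * lam⌉₊ with hL
  have hL1 : 128 * q * lam ≤ L := Nat.le_ceil _
  have hL2 : (L : ℝ) < 128 * q * lam + 1 := Nat.ceil_lt_add_one (by positivity)
  have hpart := partitionFn_le (leftNeighbors G) (by omega) h.card_leftNeighbors hco
    (η := 1 / n) (R := R) (by positivity) (fun k hk => half_pow_le_inv (by omega) ha1 hk)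
    (by rw [Fintype.card_fin]; exact_mod_cast hm0)
    (by rw [Fintype.card_fin]; field_simp; exact hR1)
    (by rw [Fintype.card_fin, hR]; field_simp; rfl) hy0.le n univ ∅ L (by simp) (by
      have h1 : totalWeight (leftNeighbors G) univ ∅ ≤ n := by
        calc _ ≤ ∑ x : Fin n, (1 : ℝ) := sum_le_sum fun x _ => hitWeight_le_one _ _ _
          _ = n := by simp
      have h2 : lam ≤ (a : ℝ) ^ 2 / (128 * Fintype.card (Fin m)) * L := by
        rw [Fintype.card_fin]
        calc lam = (a : ℝ) ^ 2 / (128 * m) * (128 * q * lam) := by rw [hq]; field_simp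
          _ ≤ _ := mul_le_mul_of_nonneg_left hL1 (by positivity)
      have h3 := Real.exp_le_exp.2 h2
      rw [hlamexp] at h3
      nlinarith)
  have h1 : (1 + (n : ℝ) * y) ≤ Real.exp (2 * lam) := by
    rw [two_mul, Real.exp_add, hlamexp]
    nlinarith
  have h2 : (1 + (n : ℝ) * y) ^ L ≤ Real.exp (L * (2 * lam)) := by
    rw [Real.exp_nat_mul]
    exact pow_le_pow_left₀ (by positivity) h1 L
  have h3 : y * R = 32 * q * lam ^ 2 := by rw [hy, hR, hq]; field_simp
  calc _ ≤ _ := hpart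
    _ ≤ Real.exp (L * (2 * lam)) * Real.exp (y * R) :=
      mul_le_mul_of_nonneg_right h2 (Real.exp_pos _).le
    _ = Real.exp (L * (2 * lam) + y * R) := (Real.exp_add _ _).symm
    _ ≤ Real.exp (300 * q * lam ^ 2) := by
      refine Real.exp_le_exp.2 ?_
      rw [h3]
      have h4 : (L : ℝ) * (2 * lam) ≤ (128 * q * lam + 1) * (2 * lam) :=
        mul_le_mul_of_nonneg_right hL2.le (by linarith)
      have h5 : 1 / 4 ≤ q * lam := by nlinarith
      nlinarith

/-- The lower bound on the Ramsey number in terms of the parameters of the incidence graph. -/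
lemma IsMNABGraph.lt_ramseyNumber (h : IsMNABGraph m n a b G) {ℓ : ℕ} (hℓ : 1 ≤ ℓ)
    (hg : ((4 * ℓ + 2 : ℕ) : ℕ∞) < G.egirth) (hn : 2 ≤ n) (ha : 2 ≤ a)
    (ha1 : 4 * Real.log n ≤ a) (ha2 : Real.log n ^ 2 ≤ a) {t M : ℕ}
    (ht : 300 * ((m : ℝ) / a ^ 2) * Real.log n ^ 2 ≤ t)
    (hM : (M : ℝ) ≤ n * Real.log n ^ 2 / (8 * a)) :
    M < ramseyNumber (cycleGraph (2 * ℓ + 1)) t := by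
  have hg6 : ((6 : ℕ) : ℕ∞) < G.egirth := by
    refine lt_of_le_of_lt ?_ hg
    exact_mod_cast (by omega : 6 ≤ 4 * ℓ + 2)
  have hN : ∀ v, ∀ u ∈ leftNeighbors G v, G.Adj (Sum.inl u) (Sum.inr v) :=
    fun v u hu => mem_leftNeighbors.1 hu
  have hcube : (a : ℝ) ^ 3 ≤ 4 * m := by exact_mod_cast h.cube_le hg6 ha (by omega)
  have hbound := (h.partitionFn_le_exp hg6 hn ha ha1 ha2).trans (Real.exp_le_exp.2 ht)
  have hn' : (2 : ℝ) ≤ n := by exact_mod_cast hn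
  have ha' : (2 : ℝ) ≤ a := by exact_mod_cast ha
  have hm0 : 0 < (m : ℝ) := by nlinarith
  set lam := Real.log n with hlam
  have hlam0 : 0 < lam := Real.log_pos (by linarith)
  set y : ℝ := lam ^ 2 / a with hy
  have hy0 : 0 < y := by positivity
  have hy1 : y ≤ 1 := by rw [hy, div_le_one (by linarith)]; exact ha2
  have ht0 : 0 < t := by
    have : (0 : ℝ) < t := lt_of_lt_of_le (by positivity) ht
    exact_mod_cast this
  have hM' : (M : ℝ) ≤ y * n / 8 := by
    rw [hy]; convert hM using 1; field_simp
  obtain ⟨χ, X, hX, hind⟩ := exists_splitGraph_no_indep (leftNeighbors G) hy0 (t := t) (M := M)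
    (by
      rw [Fintype.card_fin]
      have : (M : ℝ) ≤ n := by nlinarith
      exact_mod_cast this)
    (by
      rw [Fintype.card_fin]
      have h1 : Real.exp t = Real.exp 1 ^ t := by rw [← Real.exp_nat_mul, mul_one]
      -- The constant `8` in the bound on `M` only has to exceed `e`.
      have h2 : Real.exp 1 * M < y * n := by
        have h2 := Real.exp_one_lt_d9
        have h3 : (0 : ℝ) < y * n := by positivity
        have h4 : (0 : ℝ) ≤ M := by positivity
        nlinarith
      calc _ ≤ Real.exp t * (M : ℝ) ^ t := mul_le_mul_of_nonneg_right hbound (by positivity)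
        _ = (Real.exp 1 * M) ^ t := by rw [h1, mul_pow]
        _ < (y * n) ^ t := pow_lt_pow_left₀ h2 (by positivity) ht0.ne')
  let φ : Fin M ↪ Fin n := (X.orderEmbOfFin hX).toEmbedding
  refine _root_.lt_ramseyNumber ((splitGraph (leftNeighbors G) χ).comap φ) ?_ ?_
  · rintro ⟨f⟩
    exact splitGraph_free hℓ hg (leftNeighbors G) hN χ
      ⟨(SimpleGraph.Embedding.comap φ _).toCopy.comp f⟩
  · intro s hs
    refine hind (s.map φ) ?_ (by rw [card_map, hs.card_eq]) ?_
    · intro x hx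
      obtain ⟨i, -, rfl⟩ := mem_map.1 hx
      exact X.orderEmbOfFin_mem hX i
    · intro x hx z hz hxz
      simp only [coe_map, Set.mem_image, mem_coe] at hx hz
      obtain ⟨x, hx, rfl⟩ := hx
      obtain ⟨z, hz, rfl⟩ := hz
      exact hs.isIndepSet hx hz fun h => hxz (by rw [h])

end Incidence

/-! ### Exponent arithmetic -/

section Exponents

open Filter

variable {α α₀ β : ℝ}

lemma denominator_ge (hα : 1 ≤ α) (hβ : β ≤ 2 / 3) :
    1 / 3 ≤ α - 3 * β - α * β + 2 := by nlinarith

lemma numerator_pos (hα : 1 ≤ α) (hβ0 : 0 < β) (hβ : β ≤ 2 / 3) :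
    0 < α * β - 3 * β + 2 := by nlinarith

lemma exponent_le (hα : 1 ≤ α) (hα₀ : α ≤ α₀) (hβ0 : 0 < β) (hβ : β ≤ 2 / 3) :
    (α * β - 3 * β + 2) / (α - 3 * β - α * β + 2) ≤ 3 * (α₀ + 2) := by
  have hD := denominator_ge hα hβ
  rw [div_le_iff₀ (by linarith)]
  nlinarith

lemma log_exponent_eq (hα : 1 ≤ α) (hβ : β ≤ 2 / 3) :
    (3 * α * β - α - 3 * β + 2) / (α - 3 * β - α * β + 2) =
      2 * ((α * β - 3 * β + 2) / (α - 3 * β - α * β + 2)) - 1 := by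
  have hD := denominator_ge hα hβ
  have hD' : α - 3 * β - α * β + 2 ≠ 0 := by linarith
  field_simp
  ring

/-- In the range `β ≤ 1 / 2` the claimed bound is at most linear. -/
lemma rpow_div_logb_rpow_le {e t : ℝ} (he0 : 0 ≤ e) (he1 : e ≤ 1) (ht : 2 ≤ t) :
    t ^ e / Real.logb 2 t ^ (2 * e - 1) ≤ 4 * t := by
  have ht0 : 0 < t := by linarith
  set L := Real.logb 2 t with hL
  have hL1 : 1 ≤ L := by
    rw [hL, Real.le_logb_iff_rpow_le (by norm_num) ht0]; simpa using ht
  have hL0 : 0 < L := by linarith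
  have hsq : L ^ 2 ≤ 4 * t := by
    have h1 : L = 2 * Real.logb 2 (Real.sqrt t) := by
      rw [hL, Real.logb, Real.logb, Real.log_sqrt ht0.le]; ring
    have h2 : Real.logb 2 (Real.sqrt t) ≤ Real.sqrt t := by
      rw [Real.logb_le_iff_le_rpow (by norm_num) (Real.sqrt_pos.2 ht0)]
      have h3 := one_add_mul_self_le_rpow_one_add (s := 1) (by norm_num)
        (show 1 ≤ Real.sqrt t from Real.one_le_sqrt.2 (by linarith))
      norm_num at h3
      linarith
    have h4 : 0 ≤ Real.sqrt t := Real.sqrt_nonneg t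
    have h5 := Real.sq_sqrt ht0.le
    nlinarith
  -- Isolating `L²/t`, which is at most `4`, leaves an exponent `1 - e` in `[0, 1]`.
  have h1 : t ^ e / L ^ (2 * e - 1) = t / L * (L ^ 2 / t) ^ (1 - e) := by
    rw [Real.div_rpow (by positivity) ht0.le, ← Real.rpow_natCast L 2, ← Real.rpow_mul hL0.le]
    rw [Real.rpow_sub ht0, Real.rpow_sub hL0, Real.rpow_one, Real.rpow_one]
    rw [show ((2 : ℕ) : ℝ) * (1 - e) = 2 - 2 * e by push_cast; ring, Real.rpow_sub hL0]
    have := Real.rpow_pos_of_pos ht0 e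
    have := Real.rpow_pos_of_pos hL0 (2 * e)
    field_simp
    norm_num
  rw [h1]
  have h2 : (L ^ 2 / t) ^ (1 - e) ≤ 4 := by
    calc (L ^ 2 / t) ^ (1 - e) ≤ (4 : ℝ) ^ (1 - e) :=
          Real.rpow_le_rpow (by positivity) ((div_le_iff₀ ht0).2 hsq) (by linarith)
      _ ≤ (4 : ℝ) ^ (1 : ℝ) := Real.rpow_le_rpow_of_exponent_le (by norm_num) (by linarith)
      _ = 4 := Real.rpow_one 4
  have h3 : t / L ≤ t := div_le_self ht0.le hL1
  calc _ ≤ t * 4 := mul_le_mul h3 h2 (by positivity) ht0.le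
    _ = _ := by ring

/-- The density hypothesis as a linear inequality between logarithms. -/
lemma log_density {m n a b c : ℝ} (hm : 0 < m) (hn : 0 < n) (ha : 0 < a)
    (hb : Real.log b = α * Real.log a) (hb0 : 0 < b) (hdc : n * a = m * b) (hc : 0 < c)
    (he : c * (m * n) ^ β ≤ n * a) :
    Real.log m = Real.log n + (1 - α) * Real.log a ∧
      Real.log c + (2 * β - 1) * Real.log n ≤ (1 - β + α * β) * Real.log a := by
  have h1 : Real.log m = Real.log n + (1 - α) * Real.log a := by
    have := congrArg Real.log hdc
    rw [Real.log_mul hn.ne' ha.ne', Real.log_mul hm.ne' hb0.ne', hb] at this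
    linarith
  refine ⟨h1, ?_⟩
  have h2 := Real.log_le_log (by positivity) he
  rw [Real.log_mul hc.ne' (by positivity), Real.log_rpow (by positivity),
    Real.log_mul hm.ne' hn.ne', Real.log_mul hn.ne' ha.ne', h1] at h2
  nlinarith

/-- With `ν = log n` and `A = log a`, this compares a power of `m/a²` with `n/a`. Writing the
exponent as `E/D`, the difference `D(ν - A) - E(ν - (1+α)A)` is exactly `α` times the difference of
the sides of the density inequality without `lc`; hence the form of the exponent. -/
lemma exponent_mul_le {ν A lc : ℝ} (hα : 1 ≤ α) (hα₀ : α ≤ α₀) (hβ : β ≤ 2 / 3) (hlc : lc ≤ 0)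
    (hden : lc + (2 * β - 1) * ν ≤ (1 - β + α * β) * A) :
    (α * β - 3 * β + 2) / (α - 3 * β - α * β + 2) * (ν - (1 + α) * A) ≤
      ν - A - 3 * α₀ * lc := by
  have hD := denominator_ge hα hβ
  have hD0 : 0 < α - 3 * β - α * β + 2 := by linarith
  rw [div_mul_eq_mul_div, div_le_iff₀ hD0]
  have h1 := mul_le_mul_of_nonneg_left hden (by linarith : (0 : ℝ) ≤ α)
  have h2 : α ≤ 3 * α₀ * (α - 3 * β - α * β + 2) := by
    have := mul_le_mul_of_nonneg_left hD (by linarith : (0 : ℝ) ≤ 3 * α₀)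
    linarith
  have h3 := mul_le_mul_of_nonpos_right h2 hlc
  linear_combination h1 + h3

/-- The claimed bound is at most `n (log n) ^ 2 / (8 a)` for `t` of order `m (log n) ^ 2 / a ^ 2`. -/
lemma claimed_bound_le {m n a c δ t lam C : ℝ} (hα : 1 ≤ α) (hα₀ : α ≤ α₀)
    (hβ1 : 1 / 2 < β) (hβ : β ≤ 2 / 3) (hm : 0 < m) (hn : 0 < n) (ha : 0 < a)
    (hmlog : Real.log m = Real.log n + (1 - α) * Real.log a) (hc : 0 < c) (hc1 : c ≤ 1)
    (hden : Real.log c + (2 * β - 1) * Real.log n ≤ (1 - β + α * β) * Real.log a)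
    (hδ : 0 < δ) (hδ1 : δ ≤ 1) (hlam : 1 ≤ lam) (ht : 0 < t)
    (ht1 : t ≤ 301 * (m / a ^ 2) * lam ^ 2) (ht2 : δ * lam ≤ Real.logb 2 t) (hC : 0 < C)
    (hC' : Real.log C ≤ -(Real.log 8 + 3 * (α₀ + 2) * Real.log 301 -
      2 * (3 * (α₀ + 2)) * Real.log δ - 3 * α₀ * Real.log c)) :
    C * (t ^ ((α * β - 3 * β + 2) / (α - 3 * β - α * β + 2)) /
      Real.logb 2 t ^ ((3 * α * β - α - 3 * β + 2) / (α - 3 * β - α * β + 2))) ≤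
        n * lam ^ 2 / (8 * a) := by
  have hβ0 : 0 < β := by linarith
  rw [log_exponent_eq hα hβ]
  have he := exponent_le hα hα₀ hβ0 hβ
  have hD := denominator_ge hα hβ
  have hE := numerator_pos hα hβ0 hβ
  set D := α - 3 * β - α * β + 2 with hDdef
  set E := α * β - 3 * β + 2 with hEdef
  set e := E / D with hedef
  have heD : e * D = E := div_mul_cancel₀ _ (by linarith)
  -- `E - D = α(2β - 1)`. The bound makes `2e - 1` positive, so a lower bound on `logb 2 t` can be
  -- used.
  have he1 : 1 ≤ e := by
    rw [hedef, le_div_iff₀ (by linarith), hDdef, hEdef]; nlinarith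
  have hlam0 : 0 < lam := by linarith
  have hL0 : 0 < Real.logb 2 t := lt_of_lt_of_le (by positivity) ht2
  rw [← Real.log_le_log_iff (by positivity) (by positivity)]
  rw [Real.log_mul hC.ne' (by positivity), Real.log_div (by positivity) (by positivity),
    Real.log_rpow ht, Real.log_rpow hL0, Real.log_div (by positivity) (by positivity),
    Real.log_mul hn.ne' (by positivity), Real.log_mul (by norm_num) ha.ne', Real.log_pow]
  have h1 := Real.log_le_log ht ht1
  rw [Real.log_mul (by positivity) (by positivity), Real.log_mul (by positivity) (by positivity),
    Real.log_div hm.ne' (by positivity), Real.log_pow, Real.log_pow, hmlog] at h1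
  have h2 := Real.log_le_log (by positivity) ht2
  rw [Real.log_mul hδ.ne' hlam0.ne'] at h2
  have hllam : 0 ≤ Real.log lam := Real.log_nonneg hlam
  have hlδ : Real.log δ ≤ 0 := Real.log_nonpos hδ.le hδ1
  have hlc : Real.log c ≤ 0 := Real.log_nonpos hc.le hc1
  have h301 : 0 < Real.log 301 := Real.log_pos (by norm_num)
  set ν := Real.log n
  set A := Real.log a
  have key : e * (ν - (1 + α) * A) ≤ ν - A - 3 * α₀ * Real.log c :=
    exponent_mul_le hα hα₀ hβ hlc hden
  push_cast at h1 ⊢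
  have h7 : e * Real.log t ≤ e * (Real.log 301 + (ν + (1 - α) * A - 2 * A) + 2 * Real.log lam) :=
    mul_le_mul_of_nonneg_left h1 (by linarith)
  have h8 : (2 * e - 1) * (Real.log δ + Real.log lam) ≤
      (2 * e - 1) * Real.log (Real.logb 2 t) := mul_le_mul_of_nonneg_left h2 (by linarith)
  have h9 : e * Real.log 301 ≤ 3 * (α₀ + 2) * Real.log 301 :=
    mul_le_mul_of_nonneg_right he h301.le
  have h10 : 2 * (3 * (α₀ + 2)) * Real.log δ ≤ (2 * e - 1) * Real.log δ :=
    mul_le_mul_of_nonpos_right (by linarith) hlδ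
  -- The powers of `lam` leave one factor `lam ≥ 1` to spare.
  linarith

end Exponents

/-! ### Choice of parameters and the theorem -/

section Main

open SimpleGraph Filter

lemma cycleGraph_odd_ne_bot {ℓ : ℕ} (hℓ : 1 ≤ ℓ) : cycleGraph (2 * ℓ + 1) ≠ ⊥ := by
  obtain ⟨l, rfl⟩ : ∃ l, ℓ = l + 1 := ⟨ℓ - 1, by omega⟩
  intro h
  have h1 : (cycleGraph (2 * l + 1 + 2)).Adj 1 0 := by
    rw [cycleGraph_adj]; simp
  change cycleGraph (2 * l + 1 + 2) = ⊥ at h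
  rw [h] at h1
  exact h1

/-- For bases `0` and `1` the default value of `Real.logb` is `0`. -/
lemma two_le_of_one_le_logb {a b : ℕ} (h : 1 ≤ Real.logb a b) : 2 ≤ a := by
  by_contra hlt
  interval_cases a <;> simp [Real.logb] at h <;> linarith

/-- One `C` and one threshold `Λ` serve all graphs. The bound `log n ≤ t` later gives `t i → ∞`; the
bound on `log C` handles the exceptional indices, where `t = 2`. -/
lemma exists_param {α₀ β c : ℝ} (hα₀ : 1 ≤ α₀) (hβ1 : 1 / 2 < β) (hβ : β ≤ 2 / 3)
    (hc : 0 < c) (hc1 : c ≤ 1) {ℓ : ℕ} (hℓ : 1 ≤ ℓ) :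
    ∃ C : ℝ, 0 < C ∧ Real.log C ≤ -(3 * (α₀ + 2) * Real.log 301) ∧ ∃ Λ : ℝ,
      ∀ (m n a b : ℕ) (α : ℝ) (G : SimpleGraph (Fin m ⊕ Fin n)),
        IsMNABGraph m n a b G → ((4 * ℓ + 2 : ℕ) : ℕ∞) < G.egirth →
        c * ((m : ℝ) * n) ^ β ≤ (G.edgeSet.ncard : ℝ) →
        α = Real.logb a b → 1 ≤ α → α ≤ α₀ → Λ ≤ Real.log n →
        ∃ t : ℕ, 2 ≤ t ∧ Real.log n ≤ t ∧
          C * ((t : ℝ) ^ ((α * β - 3 * β + 2) / (α - 3 * β - α * β + 2)) /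
            Real.logb 2 t ^ ((3 * α * β - α - 3 * β + 2) / (α - 3 * β - α * β + 2))) ≤
              (ramseyNumber (cycleGraph (2 * ℓ + 1)) t : ℝ) := by
  -- Density forces `a ≥ n^δ`; half of the available exponent is given up to absorb `log c`.
  set δ : ℝ := (2 * β - 1) / (2 * (1 + α₀)) with hδdef
  have hδ : 0 < δ := div_pos (by linarith) (by linarith)
  have hδ1 : δ ≤ 1 := by rw [hδdef, div_le_one (by linarith)]; linarith
  have hδe : (1 + α₀) * δ = (2 * β - 1) / 2 := by
    rw [hδdef]
    have : 1 + α₀ ≠ 0 := by linarith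
    field_simp
  have hlδ : Real.log δ ≤ 0 := Real.log_nonpos hδ.le hδ1
  have hlc : Real.log c ≤ 0 := Real.log_nonpos hc.le hc1
  obtain ⟨Λ₁, hΛ₁⟩ := eventually_atTop.1
    ((isLittleO_pow_exp_pos_mul_atTop (k := 2) hδ).bound one_pos)
  set K : ℝ := Real.log 8 + 3 * (α₀ + 2) * Real.log 301 -
      2 * (3 * (α₀ + 2)) * Real.log δ - 3 * α₀ * Real.log c with hK
  refine ⟨Real.exp (-K), Real.exp_pos _, ?_, max Λ₁ (max 4 (-(2 * Real.log c) / (2 * β - 1))), ?_⟩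
  · rw [Real.log_exp, hK]
    have h1 : 0 ≤ Real.log 8 := Real.log_nonneg (by norm_num)
    nlinarith
  intro m n a b α G h hg hedge hαdef hα hα₀' hΛ
  have hlam1 : Λ₁ ≤ Real.log n := (le_max_left _ _).trans hΛ
  have hlam2 : 4 ≤ Real.log n := (le_max_left _ _).trans ((le_max_right _ _).trans hΛ)
  have hlam3 : -(2 * Real.log c) / (2 * β - 1) ≤ Real.log n :=
    (le_max_right _ _).trans ((le_max_right _ _).trans hΛ)
  have ha : 2 ≤ a := two_le_of_one_le_logb (b := b) (hαdef ▸ hα)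
  have hn : 2 ≤ n := by
    by_contra hlt
    interval_cases n <;> simp at hlam2 <;> linarith
  have hn' : (2 : ℝ) ≤ n := by exact_mod_cast hn
  have ha' : (2 : ℝ) ≤ a := by exact_mod_cast ha
  have hb' : (2 : ℝ) ≤ b := by exact_mod_cast ha.trans h.a_le_b
  have hA : 0 < Real.log a := Real.log_pos (by linarith)
  have hg6 : ((6 : ℕ) : ℕ∞) < G.egirth := by
    refine lt_of_le_of_lt ?_ hg
    exact_mod_cast (by omega : 6 ≤ 4 * ℓ + 2)
  have hcube : (a : ℝ) ^ 3 ≤ 4 * m := by exact_mod_cast h.cube_le hg6 ha (by omega)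
  have hm : (0 : ℝ) < m := by
    have : (0 : ℝ) < (a : ℝ) ^ 3 := by positivity
    linarith
  obtain ⟨hmlog, hden⟩ := log_density (α := α) (β := β) (c := c) hm (by linarith : (0 : ℝ) < n)
    (by linarith : (0 : ℝ) < a) (b := b)
    (by rw [hαdef, Real.logb, div_mul_cancel₀ _ hA.ne']) (by linarith)
    (by exact_mod_cast h.double_count) hc (hedge.trans (by exact_mod_cast h.ncard_edgeSet_le))
  set lam := Real.log n with hlam
  have hAδ : δ * lam ≤ Real.log a := by
    have h1 : -(2 * Real.log c) ≤ lam * (2 * β - 1) := (div_le_iff₀ (by linarith)).1 hlam3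
    have h2 : (1 - β + α * β) * Real.log a ≤ (1 + α₀) * Real.log a :=
      mul_le_mul_of_nonneg_right (by nlinarith) hA.le
    have h3 : (1 + α₀) * (δ * lam) ≤ (1 + α₀) * Real.log a := by
      rw [← mul_assoc, hδe]; linarith
    exact le_of_mul_le_mul_left h3 (by linarith)
  have haexp : lam ^ 2 ≤ a := by
    have h1 := hΛ₁ lam hlam1
    rw [one_mul, Real.norm_of_nonneg (by positivity), Real.norm_of_nonneg (Real.exp_pos _).le] at h1
    refine h1.trans ?_
    rw [← Real.le_log_iff_exp_le (by linarith)]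
    exact hAδ
  set q : ℝ := (m : ℝ) / a ^ 2 with hq
  have hqa : (a : ℝ) ≤ 4 * q := by
    rw [hq, ← mul_div_assoc, le_div_iff₀ (by positivity)]; linarith
  have h4lam : 4 * lam ≤ lam ^ 2 := by
    rw [sq]; exact mul_le_mul_of_nonneg_right hlam2 (by linarith)
  have hlamsq : 16 ≤ lam ^ 2 := by linarith
  have hq0 : 1 ≤ q := by linarith
  have hqlam : 1 ≤ q * lam ^ 2 := one_le_mul_of_one_le_of_one_le hq0 (by linarith)
  -- Rounding up adds less than `1 ≤ q * lam ^ 2`, whence the constant `301`.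
  set t : ℕ := ⌈300 * q * lam ^ 2⌉₊ with ht
  have ht1 : 300 * q * lam ^ 2 ≤ t := Nat.le_ceil _
  have ht2 : (t : ℝ) < 300 * q * lam ^ 2 + 1 := Nat.ceil_lt_add_one (by linarith)
  have hat : (a : ℝ) ≤ t := by
    have := mul_le_mul_of_nonneg_left hlamsq (by linarith : 0 ≤ q)
    linarith
  have ht0 : (0 : ℝ) < t := by linarith
  refine ⟨t, by exact_mod_cast ha'.trans hat, by linarith, ?_⟩
  have hlogt : δ * lam ≤ Real.logb 2 t := by
    have h1 : Real.log a ≤ Real.log t := Real.log_le_log (by linarith) hat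
    have h2 : Real.log t ≤ Real.logb 2 t := by
      rw [Real.logb]
      refine le_div_self (hA.le.trans h1) (Real.log_pos one_lt_two) ?_
      linarith [Real.log_two_lt_d9]
    linarith
  have hclaim := claimed_bound_le (C := Real.exp (-K)) (t := t) hα hα₀' hβ1 hβ hm
    (by linarith : (0 : ℝ) < n) (by linarith : (0 : ℝ) < a) hmlog hc hc1 hden hδ hδ1
    (by linarith : 1 ≤ lam) ht0 (by linarith) hlogt (Real.exp_pos _) (by rw [Real.log_exp])
  refine hclaim.trans ?_
  have hlt := h.lt_ramseyNumber hℓ hg hn ha (by linarith) haexp ht1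
    (M := ⌊(n : ℝ) * lam ^ 2 / (8 * a)⌋₊) (Nat.floor_le (by positivity))
  refine (Nat.lt_floor_add_one _).le.trans ?_
  exact_mod_cast hlt

end Main

theorem theorem3 (ℓ : ℕ) (hℓ : 1 ≤ ℓ) (α₀ : ℝ) (hα₀ : 1 ≤ α₀)
    (β : ℝ) (hβ0 : 0 < β) (hβ : β ≤ ((ℓ : ℝ) + 1) / (2 * (ℓ : ℝ) + 1))
    (c : ℝ) (hc : 0 < c) :
    ∃ C : ℝ, 0 < C ∧
      ∀ (m n a b : ℕ → ℕ) (α : ℕ → ℝ) (G : (i : ℕ) → SimpleGraph (Fin (m i) ⊕ Fin (n i))),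
        Filter.Tendsto n Filter.atTop Filter.atTop →
        (∀ i, IsMNABGraph (m i) (n i) (a i) (b i) (G i)) →
        (∀ i, ((4 * ℓ + 2 : ℕ) : ℕ∞) < (G i).egirth) →
        (∀ᶠ i in Filter.atTop,
          c * ((m i : ℝ) * (n i : ℝ)) ^ β ≤ ((G i).edgeSet.ncard : ℝ)) →
        (∀ i, α i = Real.logb (a i : ℝ) (b i : ℝ) ∧ 1 ≤ α i ∧ α i ≤ α₀) →
        ∃ t : ℕ → ℕ, Filter.Tendsto t Filter.atTop Filter.atTop ∧
          ∀ i, 2 ≤ t i ∧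
            C * ((t i : ℝ) ^ ((α i * β - 3 * β + 2) / (α i - 3 * β - α i * β + 2)) /
                (Real.logb 2 (t i : ℝ)) ^
                  ((3 * α i * β - α i - 3 * β + 2) / (α i - 3 * β - α i * β + 2)))
              ≤ (ramseyNumber (SimpleGraph.cycleGraph (2 * ℓ + 1)) (t i) : ℝ) := by
  have hβ23 : β ≤ 2 / 3 := by
    refine hβ.trans ?_
    have : (1 : ℝ) ≤ ℓ := by exact_mod_cast hℓ
    rw [div_le_div_iff₀ (by positivity) (by norm_num)]
    linarith
  have hbot := cycleGraph_odd_ne_bot hℓ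
  rcases le_or_gt β (1 / 2) with hβ1 | hβ1
  -- Here the exponent of `t` is at most `1`, so the given graphs play no role and `r(F,t) ≥ t`
  -- suffices.
  · refine ⟨1 / 4, by norm_num, fun m n a b α G _ _ _ _ hα => ⟨fun i => i + 2, ?_, fun i => ?_⟩⟩
    · exact Filter.tendsto_add_atTop_nat 2
    refine ⟨Nat.le_add_left 2 i, ?_⟩
    obtain ⟨-, hα1, -⟩ := hα i
    have hD := denominator_ge hα1 hβ23
    rw [log_exponent_eq hα1 hβ23]
    have hlin := rpow_div_logb_rpow_le (t := ((i + 2 : ℕ) : ℝ))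
      (div_nonneg (numerator_pos hα1 hβ0 hβ23).le (by linarith : 0 ≤ α i - 3 * β - α i * β + 2))
      ((div_le_one (by linarith)).2 (by nlinarith)) (by push_cast; linarith [i.cast_nonneg (α := ℝ)])
    have hr : ((i + 2 : ℕ) : ℝ) ≤ ramseyNumber (SimpleGraph.cycleGraph (2 * ℓ + 1)) (i + 2) := by
      exact_mod_cast le_ramseyNumber hbot (i + 2)
    linarith
  · obtain ⟨C, hC, hC2, Λ, hΛ⟩ := exists_param hα₀ hβ1 hβ23 (lt_min hc one_pos)
      (min_le_right c 1) hℓ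
    refine ⟨C, hC, fun m n a b α G hn hG hg hedge hα => ?_⟩
    have hlog : Filter.Tendsto (fun i => Real.log (n i)) Filter.atTop Filter.atTop :=
      Real.tendsto_log_atTop.comp (tendsto_natCast_atTop_atTop.comp hn)
    have hex : ∀ i, ∃ t : ℕ, (c * ((m i : ℝ) * (n i : ℝ)) ^ β ≤ ((G i).edgeSet.ncard : ℝ) →
        Λ ≤ Real.log (n i) → Real.log (n i) ≤ t) ∧ 2 ≤ t ∧
        C * ((t : ℝ) ^ ((α i * β - 3 * β + 2) / (α i - 3 * β - α i * β + 2)) /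
            (Real.logb 2 (t : ℝ)) ^
              ((3 * α i * β - α i - 3 * β + 2) / (α i - 3 * β - α i * β + 2)))
          ≤ (ramseyNumber (SimpleGraph.cycleGraph (2 * ℓ + 1)) t : ℝ) := by
      intro i
      obtain ⟨hαi, hα1, hα2⟩ := hα i
      by_cases hgood : c * ((m i : ℝ) * (n i : ℝ)) ^ β ≤ ((G i).edgeSet.ncard : ℝ) ∧
          Λ ≤ Real.log (n i)
      · obtain ⟨t, ht2, htn, ht⟩ := hΛ (m i) (n i) (a i) (b i) (α i) (G i) (hG i) (hg i)
          (le_trans (mul_le_mul_of_nonneg_right (min_le_left c 1) (by positivity)) hgood.1)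
          hαi hα1 hα2 hgood.2
        exact ⟨t, fun _ _ => htn, ht2, ht⟩
      -- At `t = 2` the logarithm is `1`, and the smallness of `C` gives a bound of at most `2`.
      -- Only finitely many indices land here, so `t i → ∞` survives.
      · refine ⟨2, fun h1 h2 => absurd ⟨h1, h2⟩ hgood, le_rfl, ?_⟩
        have hr : (2 : ℝ) ≤ ramseyNumber (SimpleGraph.cycleGraph (2 * ℓ + 1)) 2 := by
          exact_mod_cast le_ramseyNumber hbot 2
        refine le_trans ?_ hr
        have he := exponent_le hα1 hα2 hβ0 hβ23
        rw [Nat.cast_ofNat, Real.logb_self_eq_one one_lt_two, Real.one_rpow, div_one]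
        have h3 : Real.log (C * 2 ^ ((α i * β - 3 * β + 2) / (α i - 3 * β - α i * β + 2))) ≤
            Real.log 2 := by
          rw [Real.log_mul hC.ne' (by positivity), Real.log_rpow two_pos]
          have h4 : Real.log 2 ≤ Real.log 301 := Real.log_le_log two_pos (by norm_num)
          have h5 : 0 < Real.log 2 := Real.log_pos one_lt_two
          have h6 := mul_le_mul_of_nonneg_right he h5.le
          have h7 := mul_le_mul_of_nonneg_left h4 (by linarith : 0 ≤ 3 * (α₀ + 2))
          linarith
        exact (Real.log_le_log_iff (by positivity) two_pos).1 h3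
    choose t ht using hex
    refine ⟨t, ?_, fun i => (ht i).2⟩
    refine tendsto_natCast_atTop_iff.1 (Filter.tendsto_atTop_mono' _ ?_ hlog)
    filter_upwards [hedge, hlog.eventually_ge_atTop Λ] with i h1 h2
    exact (ht i).1 h1 h2
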